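/- Let $(W,S)$ be a finite Coxeter system with set of reflections $T=\{wsw^{-1}: w\in W, s\in S\}$, absolute length $\ell$ (the length with respect to $T$) and absolute order $v\le w:\Leftrightarrow \ell(w)=\ell(v)+\ell(v^{-1}w)$. Let $c$ be a Coxeter element (a conjugate of a product of all simple reflections in some order), $\mathrm{NC}=\mathrm{NC}(W)=\{w\in W: w\le c\}$, and let $\phi:\mathrm{NC}\to\mathrm{NC}$, $\phi(w)=w^{-1}c$, be the Kreweras map. Let $V$ be one of the following, $\Lambda=\Lambda(V)$ the lattice of linear subspaces of $V$, and $f:\mathrm{NC}\to\Lambda$ the following map. * (Real case.) $V=V_{\mathbb R}$ is the space of the geometric representation of $W$, with basis the simple roots, and $f(w)=\mathrm{mov}(w)=\mathrm{im}(w-\mathrm{id})$. * (Case $p$.) $W$ is the Weyl group of a crystallographic root system with root lattice $V_{\mathbb Z}\subseteq V_{\mathbb R}$, $p$ is a prime, $V=V_{\mathbb Z}\otimes\mathbb F_p$, and $f(w)$ is the image of $\mathrm{mov}(w)\cap V_{\mathbb Z}$ in $V$. For $t\in T$ let $\alpha_t\in V$ be the (image of the) positive root of $t$. For a bilinear form $b$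 on $V$ and $U\subseteq V$ put $U^{\perp_b}=\{v\in V: b(u,v)=0\ \text{for all } u\in U\}$. A lattice skew-automorphism is a lattice automorphism or a lattice anti-automorphism (order-reversing bijection with order-reversing inverse). A map $\Psi:\Lambda\to\Lambda$ extends $\psi:\mathrm{NC}\to\mathrm{NC}$ if $\Psi\circ f=f\circ\psi$. **Criterion.** In the real case, or in case $p$ if $p$ is compatible with the root system (every basis of $V_{\mathbb R}$ that consists of roots is mapped to a basis of $V$), let $b$ be a non-degenerate bilinear form on $V$ such that $b(\alpha_s,\alpha_t)=0$ for all reflections $s\ne t$ with $st\in\mathrm{NC}$. Then $\phi$ is a lattice anti-automorphism of $\mathrm{NC}$, and $U\mapsto U^{\perp_b}$ is a lattice anti-automorphism of $\Lambda$ that extends $\phi$. **Theorem.** Let $W$ be of type $A_n$ ($n\ge1$), $B_n$ ($n\ge2$) or $D_n$ ($n\ge3$). Consider the real case, and case $p$ for the root systems $\{\pm(e_i-e_j)\}$ of type $A_n$ (any prime $p$), $\{\pm e_i\pm e_j,\pm e_i\}$ of type $B_n$ and $\{\pm e_i\pm e_j\}$ of type $D_n$ (any prime $p\neq2$). 1.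 Let $c=lr$ with $l^2=r^2=1$, let $\phi_l:\mathrm{NC}\to\mathrm{NC}$, $\phi_l(w)=lw^{-1}l$, and let $\hat{\mathcal D}=\langle\phi_l,\phi\rangle$. Every element of $\hat{\mathcal D}$ is a lattice automorphism of $\mathrm{NC}$ that extends to a lattice automorphism of $\Lambda$, or a lattice anti-automorphism of $\mathrm{NC}$ that extends to the lattice anti-automorphism $U\mapsto U^{\perp_b}$ of $\Lambda$ for some non-degenerate bilinear form $b$ on $V$. 2. Let $\alpha_1,\dots,\alpha_n$ be the simple roots $\alpha_i=e_i-e_{i+1}$ for $i<n$, and $\alpha_n=e_n$ in types $A_n$ (with the convention $e_{n+1}=0$) and $B_n$, $\alpha_n=e_{n-1}+e_n$ in type $D_n$. Then $e_1,\dots,e_n$ is a basis of $V$; let $c=s_{\alpha_1}\cdots s_{\alpha_n}$. Define bilinear forms on $V$ by $$b_A(e_i,e_j)=\begin{cases}1& i\le j\\0& i>j\end{cases},\qquad b_B(e_i,e_j)=\begin{cases}1& i\le j\\-1& i>j\end{cases},\qquad b_D(e_i,e_j)=\begin{cases}1& i\le j<n\ \text{or}\ i=j=n\\-1& j<i<n\\0&\text{otherwise.}\end{cases}$$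 For $X\in\{A,B,D\}$ the type of $W$, the form $b_X$ is non-degenerate, $b_X(\alpha_s,\alpha_t)=0$ for all reflections $s\neq t$ with $st\in\mathrm{NC}$, and $U\mapsto U^{\perp_{b_X}}$ is a lattice anti-automorphism of $\Lambda$ that extends $\phi$. -/

import Mathlib

/-! # Non-crossing partitions of finite Coxeter groups and their embeddings into lattices of
linear subspaces -/

namespace NonCrossing

/-! ## Lattice skew-automorphisms

A bijection between lattices that preserves (reverses) the order in both directions is the same
thing as a lattice automorphism (anti-automorphism). -/

/-- `g` is a lattice automorphism. -/
def IsLatticeAut {P : Type*} [LE P] (g : P → P) : Prop :=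
  Function.Bijective g ∧ ∀ x y, g x ≤ g y ↔ x ≤ y

/-- `g` is a lattice anti-automorphism. -/
def IsLatticeAntiAut {P : Type*} [LE P] (g : P → P) : Prop :=
  Function.Bijective g ∧ ∀ x y, g x ≤ g y ↔ y ≤ x

/-- For a map `f` from a poset `P` to the lattice of linear subspaces of `V`, the self-map `g` of
`P` is a lattice anti-automorphism, and the map `U ↦ U^⊥ = {v | b(u, v) = 0 for all u ∈ U}` is a
lattice anti-automorphism that extends it. -/
def ComplementExtends {P : Type*} [LE P] {K V : Type*} [Field K] [AddCommGroup V] [Module K V]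
    (f : P → Submodule K V) (g : P → P) (b : LinearMap.BilinForm K V) : Prop :=
  IsLatticeAntiAut g ∧ IsLatticeAntiAut (fun U : Submodule K V => b.orthogonal U) ∧
    ∀ w, b.orthogonal (f w) = f (g w)

/-- `g` is a lattice automorphism of `P` that extends to a lattice automorphism of the lattice of
linear subspaces of `V`, or a lattice anti-automorphism of `P` that extends to the map
`U ↦ U^⊥` of some non-degenerate bilinear form, which is a lattice anti-automorphism. -/
def SkewExtends {P : Type*} [LE P] {K V : Type*} [Field K] [AddCommGroup V] [Module K V]
    (f : P → Submodule K V) (g : P → P) : Prop :=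
  (IsLatticeAut g ∧
    ∃ Ψ : Submodule K V → Submodule K V, IsLatticeAut Ψ ∧ ∀ w, Ψ (f w) = f (g w)) ∨
  ∃ b : LinearMap.BilinForm K V, b.Nondegenerate ∧ ComplementExtends f g b

/-! ## The geometric representation

The space `V` has the simple roots as a basis; it is `B → ℝ` in the coordinates of this basis. -/

/-- `A` is a Cartan matrix for the Coxeter matrix `M`: there are simple roots `α i` and coroots
`α i ^∨` with `A i j = ⟨α i, α j ^∨⟩` whose reflections have the orders prescribed by `M`. The
choice `A i j = - 2 cos (π / M i j)` gives the usual normalization, where all roots have the same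
length; an integral `A` gives a crystallographic root system. -/
structure IsCartan {B : Type*} (M : CoxeterMatrix B) (A : Matrix B B ℝ) : Prop where
  diag : ∀ i, A i i = 2
  nonpos : ∀ i j, i ≠ j → A i j ≤ 0
  zero : ∀ i j, A i j = 0 → A j i = 0
  prod : ∀ i j, i ≠ j → M i j ≠ 0 → A i j * A j i = 4 * Real.cos (Real.pi / M i j) ^ 2

/-- The simple root `α i`. -/
def simpleRoot {B : Type*} [DecidableEq B] (i : B) : B → ℝ := Pi.single i 1

/-- The simple coroot `v ↦ ⟨v, α j ^∨⟩ = ∑ i, v i * A i j`. -/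
noncomputable def coroot {B : Type*} [Fintype B] (A : Matrix B B ℝ) (j : B) :
    Module.Dual ℝ (B → ℝ) :=
  LinearMap.proj j ∘ₗ A.vecMulLinear

theorem coroot_simpleRoot {B : Type*} [Fintype B] [DecidableEq B] (A : Matrix B B ℝ) (i j : B) :
    coroot A j (simpleRoot i) = A i j := by
  simp [coroot, simpleRoot]

theorem coroot_self {B : Type*} [Fintype B] [DecidableEq B] {M : CoxeterMatrix B}
    {A : Matrix B B ℝ} (hA : IsCartan M A) (j : B) : coroot A j (simpleRoot j) = 2 := by
  rw [coroot_simpleRoot, hA.diag]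

/-- The simple reflection `v ↦ v - ⟨v, α j ^∨⟩ α j`. -/
noncomputable def refl {B : Type*} [Fintype B] [DecidableEq B] {M : CoxeterMatrix B}
    {A : Matrix B B ℝ} (hA : IsCartan M A) (j : B) : (B → ℝ) ≃ₗ[ℝ] (B → ℝ) :=
  Module.reflection (coroot_self hA j)

theorem refl_isLiftable {B : Type*} [Fintype B] [DecidableEq B] {M : CoxeterMatrix B}
    {A : Matrix B B ℝ} (hA : IsCartan M A) : M.IsLiftable (refl hA) := by
  intro i j
  by_cases hij : i = j
  · subst hij
    rw [M.diagonal, pow_one]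
    ext1 v
    exact Module.involutive_reflection (coroot_self hA i) v
  by_cases hm : M i j = 0
  · rw [hm, pow_zero]
  have hm1 : M i j ≠ 1 := M.off_diagonal i j hij
  have hp := hA.prod i j hij hm
  ext1 z
  by_cases hm2 : M i j = 2
  · have h0 : A i j * A j i = 0 := by rw [hp, hm2]; simp
    have h1 : A i j = 0 ∧ A j i = 0 := by
      rcases mul_eq_zero.1 h0 with h | h
      · exact ⟨h, hA.zero _ _ h⟩
      · exact ⟨hA.zero _ _ h, h⟩
    rw [hm2]
    simp only [refl, pow_two, LinearEquiv.mul_apply, Module.reflection_apply, map_sub, map_smul,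
      coroot_simpleRoot, hA.diag, h1.1, h1.2, LinearEquiv.coe_one, id_eq]
    module
  have hm3 : 3 ≤ M i j := by omega
  set m := M i j with hmdef
  have hmpos : (0 : ℝ) < m := by positivity
  set φ : ℝ := 2 * (Real.pi / m) with hφ
  have ht : coroot A i (simpleRoot j) * coroot A j (simpleRoot i) - 2 = 2 * Real.cos φ := by
    rw [coroot_simpleRoot, coroot_simpleRoot, mul_comm, hp, hφ, Real.cos_two_mul]; ring
  have hs : Real.sin φ ≠ 0 := by
    apply ne_of_gt
    apply Real.sin_pos_of_pos_of_lt_pi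
    · have := Real.pi_pos; positivity
    · rw [hφ, ← mul_div_assoc, div_lt_iff₀ hmpos]
      have : (3 : ℝ) ≤ m := by exact_mod_cast hm3
      nlinarith [Real.pi_pos]
  have hS : ∀ k : ℤ, (Polynomial.Chebyshev.S ℝ k).eval (2 * Real.cos φ) = Real.sin ((k + 1) * φ) / Real.sin φ := by
    intro k
    rw [eq_div_iff hs, Polynomial.Chebyshev.S_two_mul_real_cos]
  have key := Module.reflection_mul_reflection_pow_apply (coroot_self hA i) (coroot_self hA j) m z
  rw [ht] at key
  change ((Module.reflection (coroot_self hA i) * Module.reflection (coroot_self hA j)) ^ m) z = z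
  rw [key]
  rcases Nat.even_or_odd' m with ⟨k, hk | hk⟩
  · have e1 : ((m : ℤ) - 2) / 2 = (k : ℤ) - 1 := by omega
    have e2 : ((m : ℤ) - 1) / 2 = (k : ℤ) - 1 := by omega
    have h0 : (Polynomial.Chebyshev.S ℝ ((k : ℤ) - 1)).eval (2 * Real.cos φ) = 0 := by
      rw [hS]
      have : (((k : ℤ) - 1 : ℤ) + 1 : ℝ) * φ = Real.pi := by
        rw [hφ]; push_cast
        have : (m : ℝ) = 2 * k := by exact_mod_cast hk
        rw [this] at hmpos ⊢
        have hk0 : (k : ℝ) ≠ 0 := by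
          intro h
          simp [h] at hmpos
        field_simp
        ring
      rw [this]; simp
    rw [e1, e2, h0]; simp
  · have e1 : ((m : ℤ) - 2) / 2 = (k : ℤ) - 1 := by omega
    have e2 : ((m : ℤ) - 1) / 2 = (k : ℤ) := by omega
    have e3 : ((m : ℤ) - 3) / 2 = (k : ℤ) - 1 := by omega
    have e4 : ((m : ℤ)) / 2 = (k : ℤ) := by omega
    have h0 : (Polynomial.Chebyshev.S ℝ (k : ℤ)).eval (2 * Real.cos φ) + (Polynomial.Chebyshev.S ℝ ((k : ℤ) - 1)).eval (2 * Real.cos φ)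
        = 0 := by
      rw [hS, hS, ← add_div]
      have : (k : ℝ) * φ = 2 * Real.pi - (k + 1) * φ := by
        rw [hφ]
        have : (m : ℝ) = 2 * k + 1 := by exact_mod_cast hk
        rw [this] at hmpos ⊢
        field_simp
        ring
      push_cast
      rw [sub_add_cancel, this, Real.sin_two_pi_sub]
      simp
    rw [e1, e2, e3, e4, h0]; simp

/-- The geometric representation of a Coxeter group: the simple reflections act by `refl`. -/
noncomputable def geomRep {B W : Type*} [Fintype B] [DecidableEq B] [Group W]
    {M : CoxeterMatrix B} {A : Matrix B B ℝ} (cs : CoxeterSystem M W) (hA : IsCartan M A) :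
    W →* ((B → ℝ) ≃ₗ[ℝ] (B → ℝ)) :=
  cs.lift ⟨refl hA, refl_isLiftable hA⟩

/-- The moved space `mov(w)`, the image of `w - id`. -/
noncomputable def mov {B W : Type*} [Fintype B] [DecidableEq B] [Group W]
    {M : CoxeterMatrix B} {A : Matrix B B ℝ} (cs : CoxeterSystem M W) (hA : IsCartan M A)
    (w : W) : Submodule ℝ (B → ℝ) :=
  LinearMap.range ((geomRep cs hA w : (B → ℝ) →ₗ[ℝ] (B → ℝ)) - LinearMap.id)

/-- The reduction modulo `p` of the intersection of `U` with the root lattice, which consists of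
the vectors with integral coordinates in the basis of simple roots. -/
def reduceSubspace {B : Type*} (p : ℕ) (U : Submodule ℝ (B → ℝ)) :
    Submodule (ZMod p) (B → ZMod p) :=
  Submodule.span (ZMod p)
    {v | ∃ z : B → ℤ, (fun i => (z i : ℝ)) ∈ U ∧ v = fun i => (z i : ZMod p)}

/-- The `p`-moved space of `w`. -/
noncomputable def movP {B W : Type*} [Fintype B] [DecidableEq B] [Group W]
    {M : CoxeterMatrix B} {A : Matrix B B ℝ} (cs : CoxeterSystem M W) (hA : IsCartan M A)
    (p : ℕ) (w : W) : Submodule (ZMod p) (B → ZMod p) :=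
  reduceSubspace p (mov cs hA w)

/-- `v` is a root of the reflection `t`: for some `u` and some simple reflection `s` with root
`α`, one has `t = u s u⁻¹` and `v = u α`. This allows the positive root of `t` and its negative. -/
def IsRootOf {B W : Type*} [Fintype B] [DecidableEq B] [Group W]
    {M : CoxeterMatrix B} {A : Matrix B B ℝ} (cs : CoxeterSystem M W) (hA : IsCartan M A)
    (t : W) (v : B → ℝ) : Prop :=
  ∃ u i, t = u * cs.simple i * u⁻¹ ∧ v = geomRep cs hA u (simpleRoot i)

/-- The integral vector `z` is a root of the reflection `t`. -/
def IsIntRootOf {B W : Type*} [Fintype B] [DecidableEq B] [Group W]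
    {M : CoxeterMatrix B} {A : Matrix B B ℝ} (cs : CoxeterSystem M W) (hA : IsCartan M A)
    (t : W) (z : B → ℤ) : Prop :=
  IsRootOf cs hA t (fun i => (z i : ℝ))

/-- The prime `p` is compatible with the root system: every basis of `V` that consists of roots
is mapped to a basis by reduction modulo `p`. -/
def Compatible {B W : Type*} [Fintype B] [DecidableEq B] [Group W]
    {M : CoxeterMatrix B} {A : Matrix B B ℝ} (cs : CoxeterSystem M W) (hA : IsCartan M A)
    (p : ℕ) : Prop :=
  ∀ z : B → (B → ℤ), (∀ k, ∃ t, IsIntRootOf cs hA t (z k)) →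
    LinearIndependent ℝ (fun k i => (z k i : ℝ)) →
    LinearIndependent (ZMod p) (fun k i => (z k i : ZMod p))

/-! ## Absolute order and non-crossing partitions -/

/-- The absolute (reflection) length of `w`: the least number of reflections with product `w`. -/
noncomputable def absLength {B W : Type*} [Group W] {M : CoxeterMatrix B}
    (cs : CoxeterSystem M W) (w : W) : ℕ :=
  sInf {k | ∃ ts : List W, ts.length = k ∧ (∀ t ∈ ts, cs.IsReflection t) ∧ ts.prod = w}

/-- The absolute order. -/
def AbsLE {B W : Type*} [Group W] {M : CoxeterMatrix B} (cs : CoxeterSystem M W) (v w : W) :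
    Prop :=
  absLength cs w = absLength cs v + absLength cs (v⁻¹ * w)

/-- A Coxeter element: a conjugate of a product of all simple reflections in some order. -/
def IsCoxeterElement {B W : Type*} [Group W] {M : CoxeterMatrix B} (cs : CoxeterSystem M W)
    (c : W) : Prop :=
  ∃ l : List B, l.Nodup ∧ (∀ i, i ∈ l) ∧ ∃ w, c = w * cs.wordProd l * w⁻¹

/-- The non-crossing partitions `NC(W)` with respect to `c`. -/
def NC {B W : Type*} [Group W] {M : CoxeterMatrix B} (cs : CoxeterSystem M W) (c : W) : Type _ :=
  {w : W // AbsLE cs w c}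

/-- The order on `NC(W)` is the absolute order. -/
instance {B W : Type*} [Group W] {M : CoxeterMatrix B} (cs : CoxeterSystem M W) (c : W) :
    LE (NC cs c) :=
  ⟨fun v w => AbsLE cs v.1 w.1⟩

/-- The reflection `s` subordinates the reflection `t`. -/
def Subordinates {B W : Type*} [Group W] {M : CoxeterMatrix B} (cs : CoxeterSystem M W) (c : W)
    (s t : W) : Prop :=
  cs.IsReflection s ∧ cs.IsReflection t ∧ s ≠ t ∧ AbsLE cs (s * t) c

theorem absLength_conj_le {B W : Type*} [Group W] {M : CoxeterMatrix B}
    (cs : CoxeterSystem M W) (u w : W) : absLength cs (u * w * u⁻¹) ≤ absLength cs w := by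
  have hne : {k | ∃ ts : List W, ts.length = k ∧ (∀ t ∈ ts, cs.IsReflection t) ∧
      ts.prod = w}.Nonempty := by
    obtain ⟨l, hl⟩ := cs.wordProd_surjective w
    refine ⟨_, l.map cs.simple, rfl, ?_, hl⟩
    intro t ht
    obtain ⟨i, -, rfl⟩ := List.mem_map.1 ht
    exact cs.isReflection_simple i
  obtain ⟨ts, h1, h2, h3⟩ := Nat.sInf_mem hne
  refine Nat.sInf_le ⟨ts.map (MulAut.conj u), ?_, ?_, ?_⟩
  · rw [List.length_map, h1, absLength]
  · intro t ht
    obtain ⟨t₀, h, rfl⟩ := List.mem_map.1 ht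
    exact (h2 t₀ h).conj u
  · rw [← map_list_prod, h3, MulAut.conj_apply]

theorem absLength_conj {B W : Type*} [Group W] {M : CoxeterMatrix B}
    (cs : CoxeterSystem M W) (u w : W) : absLength cs (u * w * u⁻¹) = absLength cs w := by
  apply le_antisymm (absLength_conj_le cs u w)
  have h := absLength_conj_le cs u⁻¹ (u * w * u⁻¹)
  rwa [show u⁻¹ * (u * w * u⁻¹) * u⁻¹⁻¹ = w by group] at h

theorem absLength_inv {B W : Type*} [Group W] {M : CoxeterMatrix B}
    (cs : CoxeterSystem M W) (w : W) : absLength cs w⁻¹ = absLength cs w := by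
  have key : ∀ w : W, ∀ k, (∃ ts : List W, ts.length = k ∧ (∀ t ∈ ts, cs.IsReflection t) ∧
      ts.prod = w) → ∃ ts : List W, ts.length = k ∧ (∀ t ∈ ts, cs.IsReflection t) ∧
      ts.prod = w⁻¹ := by
    rintro w k ⟨ts, h1, h2, h3⟩
    refine ⟨(ts.map (fun x => x⁻¹)).reverse, by simp [h1], ?_, ?_⟩
    · intro t ht
      rw [List.mem_reverse, List.mem_map] at ht
      obtain ⟨t₀, h, rfl⟩ := ht
      exact (h2 t₀ h).isReflection_inv
    · rw [← List.prod_inv_reverse, h3]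
  unfold absLength
  congr 1
  ext k
  exact ⟨fun h => by simpa using key _ k h, key w k⟩

theorem absLE_kreweras {B W : Type*} [Group W] {M : CoxeterMatrix B}
    {cs : CoxeterSystem M W} {c w : W} (h : AbsLE cs w c) : AbsLE cs (w⁻¹ * c) c := by
  unfold AbsLE at h ⊢
  rw [show (w⁻¹ * c)⁻¹ * c = c⁻¹ * w * c⁻¹⁻¹ by group, absLength_conj, h, add_comm]

theorem absLE_kreweras_symm {B W : Type*} [Group W] {M : CoxeterMatrix B}
    {cs : CoxeterSystem M W} {c w : W} (h : AbsLE cs w c) : AbsLE cs (c * w⁻¹) c := by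
  unfold AbsLE at h ⊢
  rw [show (c * w⁻¹)⁻¹ * c = w by group, h, add_comm,
    show c * w⁻¹ = w * (w⁻¹ * c) * w⁻¹ by group, absLength_conj]

/-- The Kreweras map `φ : w ↦ w⁻¹ c`. -/
def kreweras {B W : Type*} [Group W] {M : CoxeterMatrix B} (cs : CoxeterSystem M W) (c : W) :
    Equiv.Perm (NC cs c) where
  toFun w := ⟨w.1⁻¹ * c, absLE_kreweras w.2⟩
  invFun w := ⟨c * w.1⁻¹, absLE_kreweras_symm w.2⟩
  left_inv w := Subtype.ext (by simp)
  right_inv w := Subtype.ext (by simp)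

/-- A bipartition `c = l r` of `c` into two elements with `l² = r² = 1`. -/
structure IsBipartition {W : Type*} [Group W] (c l r : W) : Prop where
  eq : c = l * r
  left : l * l = 1
  right : r * r = 1

theorem absLE_phiLeft {B W : Type*} [Group W] {M : CoxeterMatrix B} {cs : CoxeterSystem M W}
    {c l r w : W} (hb : IsBipartition c l r) (h : AbsLE cs w c) :
    AbsLE cs (l * w⁻¹ * l) c := by
  have hl : l⁻¹ = l := inv_eq_of_mul_eq_one_left hb.left
  have hr : r⁻¹ = r := inv_eq_of_mul_eq_one_left hb.right
  have e1 : absLength cs (l * w⁻¹ * l) = absLength cs w := by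
    conv_lhs => rw [show l * w⁻¹ * l = l * w⁻¹ * l⁻¹ by rw [hl]]
    rw [absLength_conj, absLength_inv]
  have e2 : absLength cs ((l * w⁻¹ * l)⁻¹ * c) = absLength cs (w⁻¹ * c) := by
    have : (l * w⁻¹ * l)⁻¹ * c = (l * w) * (w⁻¹ * c)⁻¹ * (l * w)⁻¹ := by
      have hc : c⁻¹ = r * l := by rw [hb.eq, mul_inv_rev, hl, hr]
      have hc2 : l * c = r := by rw [hb.eq, ← mul_assoc, hb.left, one_mul]
      simp only [mul_inv_rev, inv_inv, hl, hc]
      calc l * (w * l) * c = l * w * (l * c) := by group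
        _ = l * w * r := by rw [hc2]
        _ = l * w * r * (l * l) := by rw [hb.left, mul_one]
        _ = l * w * (r * l * w) * (w⁻¹ * l) := by group
    rw [this, absLength_conj, absLength_inv]
  unfold AbsLE at h ⊢
  rw [e1, e2, h]

/-- The map `φ_l : w ↦ l w⁻¹ l`. -/
def phiLeft {B W : Type*} [Group W] {M : CoxeterMatrix B} (cs : CoxeterSystem M W) {c l r : W}
    (hb : IsBipartition c l r) : Equiv.Perm (NC cs c) where
  toFun w := ⟨l * w.1⁻¹ * l, absLE_phiLeft hb w.2⟩
  invFun w := ⟨l * w.1⁻¹ * l, absLE_phiLeft hb w.2⟩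
  left_inv w := Subtype.ext (by
    have hl : l⁻¹ = l := inv_eq_of_mul_eq_one_left hb.left
    simp only [mul_inv_rev, inv_inv, hl]
    calc l * (l * (w.1 * l)) * l = (l * l) * w.1 * (l * l) := by group
      _ = w.1 := by rw [hb.left, one_mul, mul_one])
  right_inv w := Subtype.ext (by
    have hl : l⁻¹ = l := inv_eq_of_mul_eq_one_left hb.left
    simp only [mul_inv_rev, inv_inv, hl]
    calc l * (l * (w.1 * l)) * l = (l * l) * w.1 * (l * l) := by group
      _ = w.1 := by rw [hb.left, one_mul, mul_one])

/-- The dihedral group generated by `φ_l` and the Kreweras map. -/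
def dihedral {B W : Type*} [Group W] {M : CoxeterMatrix B} (cs : CoxeterSystem M W) {c l r : W}
    (hb : IsBipartition c l r) : Subgroup (Equiv.Perm (NC cs c)) :=
  Subgroup.closure {phiLeft cs hb, kreweras cs c}

/-! ## The classical types -/

/-- The classical types. -/
inductive ClassicalType
  | A
  | B
  | D

namespace ClassicalType

/-- The ranks of the groups of a type are the integers that are at least `minRank`. -/
def minRank : ClassicalType → ℕ
  | A => 1
  | B => 2
  | D => 3

/-- The Cartan matrix of the root system. For type `A` the roots are `± (e i - e j)`, for type `B`
they are `± e i ± e j` and `± e i`, for type `D` they are `± e i ± e j`. -/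
def cartan (X : ClassicalType) (n : ℕ) : Matrix (Fin n) (Fin n) ℤ :=
  match X with
  | A => CartanMatrix.A n
  | B => CartanMatrix.B n
  | D => CartanMatrix.D n

/-- The Coxeter matrix of type `D`: the diagram is the path on all nodes but the last one, and the
last node is joined to the third last one only. The matrix `CoxeterMatrix.D` of the library is not
used, since it joins the last two nodes as well. -/
def coxeterMatrixD (n : ℕ) : CoxeterMatrix (Fin n) where
  M := Matrix.of fun i j => if i = j then 1 else if CartanMatrix.D n i j = 0 then 2 else 3
  isSymm := by
    ext i j
    have h : CartanMatrix.D n j i = CartanMatrix.D n i j :=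
      congrFun (congrFun (CartanMatrix.D_isSymm n) i) j
    simp only [Matrix.transpose_apply, Matrix.of_apply, h, eq_comm]
  diagonal := by simp
  off_diagonal := by
    intro i j hij
    simp only [Matrix.of_apply, if_neg hij]
    split_ifs <;> simp

/-- The Coxeter matrix of type `X` and rank `n`. -/
def coxeterMatrix (X : ClassicalType) (n : ℕ) : CoxeterMatrix (Fin n) :=
  match X with
  | A => CoxeterMatrix.A n
  | B => CoxeterMatrix.B n
  | D => coxeterMatrixD n

theorem isCartan (X : ClassicalType) (n : ℕ) :
    IsCartan (X.coxeterMatrix n) ((X.cartan n).map (Int.cast : ℤ → ℝ)) := by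
  have c4 : 4 * Real.cos (Real.pi / 4) ^ 2 = 2 := by
    rw [Real.cos_pi_div_four, div_pow, Real.sq_sqrt (by norm_num)]
    norm_num
  have c3 : 4 * Real.cos (Real.pi / 3) ^ 2 = 1 := by
    rw [Real.cos_pi_div_three]
    norm_num
  have c2 : 4 * Real.cos (Real.pi / 2) ^ 2 = 0 := by
    rw [Real.cos_pi_div_two]
    norm_num
  have cast2 : ((2 : ℕ) : ℝ) = 2 := by norm_num
  have cast3 : ((3 : ℕ) : ℝ) = 3 := by norm_num
  have cast4 : ((4 : ℕ) : ℝ) = 4 := by norm_num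
  cases X
  · constructor
    · intro i
      simp [cartan, CartanMatrix.A]
    · intro i j hij
      simp only [cartan, CartanMatrix.A, Matrix.map_apply, Matrix.of_apply, if_neg hij]
      split_ifs <;> norm_num
    · intro i j
      simp only [cartan, CartanMatrix.A, Matrix.map_apply, Matrix.of_apply, eq_comm (a := j),
        or_comm (a := j.val + 1 = i.val)]
      exact id
    · intro i j hij _
      simp only [cartan, coxeterMatrix, CoxeterMatrix.A, CartanMatrix.A, Matrix.map_apply,
        Matrix.of_apply, if_neg hij, if_neg (Ne.symm hij), or_comm (a := j.val + 1 = i.val)]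
      split_ifs
      · rw [cast3, c3]; norm_num
      · rw [cast2, c2]; norm_num
  · constructor
    · intro i
      simp [cartan, CartanMatrix.B]
    · intro i j hij
      simp only [cartan, CartanMatrix.B, Matrix.map_apply, Matrix.of_apply, if_neg hij]
      split_ifs <;> norm_num
    · intro i j
      simp only [cartan, CartanMatrix.B, Matrix.map_apply, Matrix.of_apply, Fin.ext_iff]
      split_ifs <;> first | omega | norm_num
    · intro i j hij _
      simp only [cartan, coxeterMatrix, CoxeterMatrix.B, CartanMatrix.B, Matrix.map_apply,
        Matrix.of_apply, if_neg hij, if_neg (Ne.symm hij)]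
      split_ifs <;> first
        | (exfalso; omega)
        | (rw [cast4, c4]; norm_num)
        | (rw [cast3, c3]; norm_num)
        | (rw [cast2, c2]; norm_num)
  · have hsymm : ∀ i j, CartanMatrix.D n j i = CartanMatrix.D n i j := fun i j =>
      congrFun (congrFun (CartanMatrix.D_isSymm n) i) j
    have hval : ∀ i j, i ≠ j → CartanMatrix.D n i j = 0 ∨ CartanMatrix.D n i j = -1 := by
      intro i j hij
      simp only [CartanMatrix.D, Matrix.of_apply, if_neg hij]
      split_ifs <;> simp
    constructor
    · intro i
      simp [cartan, CartanMatrix.D]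
    · intro i j hij
      simp only [cartan, Matrix.map_apply]
      rcases hval i j hij with h | h <;> rw [h] <;> norm_num
    · intro i j h
      simpa only [cartan, Matrix.map_apply, hsymm i j] using h
    · intro i j hij _
      have hM : coxeterMatrixD n i j = if CartanMatrix.D n i j = 0 then 2 else 3 := if_neg hij
      simp only [cartan, coxeterMatrix, Matrix.map_apply, hsymm i j, hM]
      rcases hval i j hij with h | h <;> rw [h]
      · simp
      · rw [if_neg (by norm_num), cast3, c3]; norm_num

/-- The coordinates of the `i`-th simple root in the basis `e`. The simple roots are
`e i - e (i + 1)` for `i + 1 < n`; the last one is `e n` for the types `A` and `B` and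
`e (n - 1) + e n` for type `D`. For type `A` this is the convention `e (n + 1) = 0`. -/
def simpleVec (X : ClassicalType) (n : ℕ) (K : Type*) [Ring K] (i : Fin n) : Fin n → K :=
  fun k =>
    match X with
    | A => if k = i then 1 else if k.val = i.val + 1 then -1 else 0
    | B => if k = i then 1 else if k.val = i.val + 1 then -1 else 0
    | D =>
      if i.val + 1 = n then (if k = i ∨ k.val + 1 = i.val then 1 else 0)
      else if k = i then 1 else if k.val = i.val + 1 then -1 else 0

/-- The values `b_X (e i, e j)` of the bilinear forms `b_A`, `b_B` and `b_D`. -/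
def gram (X : ClassicalType) (n : ℕ) (K : Type*) [Ring K] : Matrix (Fin n) (Fin n) K :=
  Matrix.of fun i j =>
    match X with
    | A => if i ≤ j then 1 else 0
    | B => if i ≤ j then 1 else -1
    | D =>
      if (i ≤ j ∧ j.val + 1 < n) ∨ (i = j ∧ j.val + 1 = n) then 1
      else if j < i ∧ i.val + 1 < n then -1 else 0

/-- The bilinear form `b_X`, in the coordinates of the basis of simple roots. -/
noncomputable def form (X : ClassicalType) (n : ℕ) (K : Type*) [Field K] :
    LinearMap.BilinForm K (Fin n → K) :=
  (Matrix.toBilin' (X.gram n K)).comp (Fintype.linearCombination K (X.simpleVec n K))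
    (Fintype.linearCombination K (X.simpleVec n K))

end ClassicalType

end NonCrossing

/-!
In a reduced factorization `w = t₁ ⋯ tₖ` of `w ≤ c`, the roots of the `tᵢ` are linearly independent
and span `mov w` (Carter's lemma). Reduced factorizations of `w` and of `w⁻¹c` concatenate to one of
`c`, in which `s t ≤ c` for any factor `s` and any later factor `t`. So the hypothesis of the
criterion makes `f w` and `f (w⁻¹c)` orthogonal for `b`; as they span `V` together, one is the
orthogonal complement of the other.

Let `β` be the invariant symmetric form. The Euler form `b` of `c`, determined by
`b ((1 - c) x) y = β x y`, satisfies the hypothesis of the criterion: on the roots of a reduced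
factorization of `c` it is triangular, with half the squared lengths on the diagonal. In the
classical types it has an integral matrix, and it stays non-degenerate modulo every prime that
divides none of these diagonal entries. For `c = s₁ ⋯ sₙ` its values on pairs of simple roots are
explicit, which identifies it with `b_X`.

The map `φ_l` is inversion, which preserves moved spaces, followed by conjugation by `l`, so it
extends by the linear action of `l`. Linear maps and orthogonal complements of non-degenerate forms
together are closed under composition.
-/

namespace NonCrossing

/-! ## The absolute order -/

section AbsoluteOrder

variable {B W : Type*} [Group W] {M : CoxeterMatrix B} (cs : CoxeterSystem M W)

/-- A reduced factorization of `w`: a factorization into reflections with as few factors as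
possible. -/
structure IsReducedFactorization (L : List W) (w : W) : Prop where
  isReflection : ∀ t ∈ L, cs.IsReflection t
  prod_eq : L.prod = w
  length_eq : L.length = absLength cs w

theorem exists_isReducedFactorization (w : W) : ∃ L, IsReducedFactorization cs L w := by
  have hne : {k | ∃ L : List W, L.length = k ∧ (∀ t ∈ L, cs.IsReflection t) ∧
      L.prod = w}.Nonempty := by
    obtain ⟨l, hl⟩ := cs.wordProd_surjective w
    refine ⟨_, l.map cs.simple, rfl, ?_, hl⟩
    simp only [List.mem_map, forall_exists_index, and_imp, forall_apply_eq_imp_iff₂]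
    exact fun i _ => cs.isReflection_simple i
  obtain ⟨L, hlen, hrefl, hprod⟩ := Nat.sInf_mem hne
  exact ⟨L, hrefl, hprod, hlen⟩

theorem absLength_prod_le {L : List W} (hL : ∀ t ∈ L, cs.IsReflection t) :
    absLength cs L.prod ≤ L.length :=
  Nat.sInf_le ⟨L, rfl, hL, rfl⟩

theorem absLength_one : absLength cs 1 = 0 := by
  simpa using absLength_prod_le cs (L := []) (by simp)

theorem absLength_le_one_of_isReflection {t : W} (ht : cs.IsReflection t) :
    absLength cs t ≤ 1 := by
  simpa using absLength_prod_le cs (L := [t]) (by simpa using ht)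

theorem absLength_mul_le (u v : W) :
    absLength cs (u * v) ≤ absLength cs u + absLength cs v := by
  obtain ⟨L, hL⟩ := exists_isReducedFactorization cs u
  obtain ⟨L', hL'⟩ := exists_isReducedFactorization cs v
  calc absLength cs (u * v) = absLength cs (L ++ L').prod := by
        rw [List.prod_append, hL.prod_eq, hL'.prod_eq]
    _ ≤ (L ++ L').length := absLength_prod_le cs fun t ht =>
        (List.mem_append.1 ht).elim (hL.isReflection t) (hL'.isReflection t)
    _ = absLength cs u + absLength cs v := by
        rw [List.length_append, hL.length_eq, hL'.length_eq]

theorem lengthParity_of_isReflection {t : W} (ht : cs.IsReflection t) :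
    cs.lengthParity t = Multiplicative.ofAdd 1 := by
  obtain ⟨u, i, rfl⟩ := ht
  rw [map_mul, map_mul, cs.lengthParity_simple, map_inv, mul_comm, inv_mul_cancel_left]

theorem absLength_mul_of_isReflection {s t : W} (hs : cs.IsReflection s)
    (ht : cs.IsReflection t) (hst : s ≠ t) : absLength cs (s * t) = 2 := by
  have hle : absLength cs (s * t) ≤ 2 := (absLength_mul_le cs s t).trans
    (add_le_add (absLength_le_one_of_isReflection cs hs) (absLength_le_one_of_isReflection cs ht))
  obtain ⟨L, hL, hprod, hlen⟩ := exists_isReducedFactorization cs (s * t)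
  match L with
  | [] => exact absurd ((eq_inv_of_mul_eq_one_left hprod.symm).trans ht.inv) hst
  | [r] =>
    rw [List.prod_singleton] at hprod
    have hr := lengthParity_of_isReflection cs (hL r (by simp))
    rw [hprod, map_mul, lengthParity_of_isReflection cs hs,
      lengthParity_of_isReflection cs ht] at hr
    exact absurd hr (by decide)
  | _ :: _ :: _ =>
    simp only [List.length_cons] at hlen
    omega

-- Each factor that is left out can be moved to the front by a conjugation.
theorem absLength_inv_prod_mul_prod_le {L L' : List W} (hL : ∀ t ∈ L, cs.IsReflection t)
    (hsub : List.Sublist L' L) :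
    absLength cs (L'.prod⁻¹ * L.prod) + L'.length ≤ L.length := by
  induction hsub with
  | slnil => simp [absLength_one]
  | @cons L' L t _ ih =>
    have ht : absLength cs (L'.prod⁻¹ * t * L'.prod⁻¹⁻¹) ≤ 1 := by
      rw [absLength_conj]
      exact absLength_le_one_of_isReflection cs (hL t (by simp))
    have hmul := absLength_mul_le cs (L'.prod⁻¹ * t * L'.prod⁻¹⁻¹) (L'.prod⁻¹ * L.prod)
    rw [show L'.prod⁻¹ * t * L'.prod⁻¹⁻¹ * (L'.prod⁻¹ * L.prod) = L'.prod⁻¹ * (t * L.prod) by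
      group] at hmul
    have := ih fun r hr => hL r (List.mem_cons_of_mem _ hr)
    rw [List.prod_cons, List.length_cons]
    omega
  | @cons_cons L' L t _ ih =>
    have := ih fun r hr => hL r (List.mem_cons_of_mem _ hr)
    rw [List.prod_cons, List.prod_cons, List.length_cons, List.length_cons,
      show (t * L'.prod)⁻¹ * (t * L.prod) = L'.prod⁻¹ * L.prod by group]
    omega

variable {cs}

namespace IsReducedFactorization

variable {c w : W} {L L' : List W}

theorem of_sublist (hL : IsReducedFactorization cs L c) (hsub : List.Sublist L' L) :
    IsReducedFactorization cs L' L'.prod ∧ AbsLE cs L'.prod c := by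
  have hrefl : ∀ t ∈ L', cs.IsReflection t := fun t ht => hL.isReflection t (hsub.subset ht)
  have hle := absLength_prod_le cs hrefl
  have hmul := absLength_mul_le cs L'.prod (L'.prod⁻¹ * c)
  have hrest := absLength_inv_prod_mul_prod_le cs hL.isReflection hsub
  rw [mul_inv_cancel_left] at hmul
  rw [hL.prod_eq, hL.length_eq] at hrest
  exact ⟨⟨hrefl, rfl, by omega⟩, by unfold AbsLE; omega⟩

theorem append (hw : AbsLE cs w c) (hL : IsReducedFactorization cs L w)
    (hL' : IsReducedFactorization cs L' (w⁻¹ * c)) : IsReducedFactorization cs (L ++ L') c where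
  isReflection t ht := (List.mem_append.1 ht).elim (hL.isReflection t) (hL'.isReflection t)
  prod_eq := by rw [List.prod_append, hL.prod_eq, hL'.prod_eq, mul_inv_cancel_left]
  length_eq := by rw [List.length_append, hL.length_eq, hL'.length_eq, hw]

theorem pairwise_subordinates (hL : IsReducedFactorization cs L c) :
    L.Pairwise (Subordinates cs c) := by
  refine List.pairwise_iff_forall_sublist.2 fun {s t} hsub => ?_
  obtain ⟨hst, hle⟩ := hL.of_sublist hsub
  refine ⟨hst.isReflection s (by simp), hst.isReflection t (by simp), ?_, by simpa using hle⟩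
  rintro rfl
  have hlen := hst.length_eq
  rw [List.prod_pair, (hst.isReflection s (by simp)).mul_self, absLength_one] at hlen
  exact absurd hlen (by simp)

theorem pair {s t : W} (hs : cs.IsReflection s) (ht : cs.IsReflection t) (hst : s ≠ t) :
    IsReducedFactorization cs [s, t] (s * t) where
  isReflection := by simp [hs, ht]
  prod_eq := List.prod_pair
  length_eq := (absLength_mul_of_isReflection cs hs ht hst).symm

end IsReducedFactorization

theorem Subordinates.exists_isReducedFactorization {c s t : W} (hst : Subordinates cs c s t) :
    ∃ L, IsReducedFactorization cs (s :: t :: L) c := by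
  obtain ⟨hs, ht, hne, hle⟩ := hst
  obtain ⟨L, hL⟩ := NonCrossing.exists_isReducedFactorization cs ((s * t)⁻¹ * c)
  exact ⟨L, .append hle (.pair hs ht hne) hL⟩

theorem absLE_conj_iff {u v w : W} :
    AbsLE cs (u * v * u⁻¹) (u * w * u⁻¹) ↔ AbsLE cs v w := by
  unfold AbsLE
  rw [show (u * v * u⁻¹)⁻¹ * (u * w * u⁻¹) = u * (v⁻¹ * w) * u⁻¹ by group]
  simp only [absLength_conj]

theorem absLE_inv_iff {v w : W} : AbsLE cs v⁻¹ w⁻¹ ↔ AbsLE cs v w := by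
  unfold AbsLE
  rw [show v⁻¹⁻¹ * w⁻¹ = w * (v⁻¹ * w)⁻¹ * w⁻¹ by group]
  simp only [absLength_conj, absLength_inv]

variable (cs) in
theorem isLatticeAntiAut_kreweras (c : W) : IsLatticeAntiAut (kreweras cs c) := by
  refine ⟨(kreweras cs c).bijective, fun ⟨u, hu⟩ ⟨v, hv⟩ => ?_⟩
  change AbsLE cs (u⁻¹ * c) (v⁻¹ * c) ↔ AbsLE cs v u
  unfold AbsLE at hu hv ⊢
  rw [show (u⁻¹ * c)⁻¹ * (v⁻¹ * c) = (v⁻¹ * c)⁻¹ * (v⁻¹ * u) * (v⁻¹ * c)⁻¹⁻¹ by group,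
    absLength_conj]
  omega

theorem IsBipartition.left_inv {c l r : W} (hb : IsBipartition c l r) : l⁻¹ = l :=
  inv_eq_of_mul_eq_one_left hb.left

theorem phiLeft_val {c l r : W} (hb : IsBipartition c l r) (w : NC cs c) :
    (phiLeft cs hb w).1 = l * w.1⁻¹ * l⁻¹ := by
  rw [hb.left_inv]
  rfl

theorem isLatticeAut_phiLeft {c l r : W} (hb : IsBipartition c l r) :
    IsLatticeAut (phiLeft cs hb) := by
  refine ⟨(phiLeft cs hb).bijective, fun u v => ?_⟩
  change AbsLE cs (phiLeft cs hb u).1 (phiLeft cs hb v).1 ↔ AbsLE cs u.1 v.1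
  rw [phiLeft_val, phiLeft_val, absLE_conj_iff, absLE_inv_iff]

end AbsoluteOrder

/-! ## Moved spaces -/

section MovedSpace

variable {R V : Type*} [Ring R] [AddCommGroup V] [Module R V]

/-- The image of `g - id`, for an automorphism `g` of any module. The moved space `mov` of an
element of a Coxeter group is the one of its action on the geometric representation. -/
def movedSpace (g : V ≃ₗ[R] V) : Submodule R V :=
  LinearMap.range ((g : V →ₗ[R] V) - LinearMap.id)

theorem sub_mem_movedSpace (g : V ≃ₗ[R] V) (x : V) : g x - x ∈ movedSpace g :=
  ⟨x, rfl⟩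

theorem movedSpace_one : movedSpace (1 : V ≃ₗ[R] V) = ⊥ := by
  rw [eq_bot_iff]
  rintro _ ⟨x, rfl⟩
  simp

theorem movedSpace_mul_le (g h : V ≃ₗ[R] V) :
    movedSpace (g * h) ≤ movedSpace g ⊔ movedSpace h := by
  rintro _ ⟨x, rfl⟩
  have hsplit : (g * h) x - x = (g (h x) - h x) + (h x - x) := (sub_add_sub_cancel _ _ _).symm
  change (g * h) x - x ∈ _
  rw [hsplit]
  exact Submodule.add_mem_sup (sub_mem_movedSpace g _) (sub_mem_movedSpace h _)

theorem movedSpace_list_prod_le (L : List (V ≃ₗ[R] V)) :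
    movedSpace L.prod ≤ ⨆ g ∈ L, movedSpace g := by
  induction L with
  | nil => simp [movedSpace_one]
  | cons g L ih =>
    simp only [List.prod_cons, List.mem_cons, iSup_or, iSup_sup_eq, iSup_iSup_eq_left]
    exact (movedSpace_mul_le g L.prod).trans (sup_le_sup_left ih _)

theorem movedSpace_conj (g h : V ≃ₗ[R] V) :
    movedSpace (g * h * g⁻¹) = (movedSpace h).map (g : V →ₗ[R] V) := by
  refine le_antisymm ?_ ?_
  · rintro _ ⟨x, rfl⟩
    exact ⟨_, sub_mem_movedSpace h (g⁻¹ x), by simp [map_sub]⟩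
  · rintro _ ⟨_, ⟨x, rfl⟩, rfl⟩
    exact ⟨g x, by simp [map_sub]⟩

theorem movedSpace_inv (g : V ≃ₗ[R] V) : movedSpace g⁻¹ = movedSpace g := by
  have inv_le : ∀ h : V ≃ₗ[R] V, movedSpace h⁻¹ ≤ movedSpace h := by
    rintro h _ ⟨x, rfl⟩
    exact ⟨-(h⁻¹ x), by simp [neg_add_eq_sub]⟩
  exact le_antisymm (inv_le g) (by simpa only [inv_inv] using inv_le g⁻¹)

end MovedSpace

theorem movedSpace_reflection {K V : Type*} [Field K] [NeZero (2 : K)] [AddCommGroup V]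
    [Module K V] {x : V} {f : Module.Dual K V} (h : f x = 2) :
    movedSpace (Module.reflection h) = Submodule.span K {x} := by
  refine le_antisymm ?_ ?_
  · rintro _ ⟨y, rfl⟩
    exact Submodule.mem_span_singleton.2 ⟨-f y, by simp [Module.reflection_apply]⟩
  · rw [Submodule.span_singleton_le_iff_mem]
    refine ⟨-(2⁻¹ : K) • x, ?_⟩
    change Module.reflection h (-(2⁻¹ : K) • x) - -(2⁻¹ : K) • x = x
    rw [map_smul, Module.reflection_apply_self, smul_neg, neg_smul, neg_neg, sub_neg_eq_add,
      ← add_smul, ← two_mul, mul_inv_cancel₀ two_ne_zero, one_smul]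

theorem movedSpace_eq_top_iff {K V : Type*} [Field K] [AddCommGroup V] [Module K V]
    [FiniteDimensional K V] {g : V ≃ₗ[K] V} :
    movedSpace g = ⊤ ↔ ∀ x, g x = x → x = 0 := by
  rw [movedSpace, ← LinearMap.ker_eq_bot_iff_range_eq_top, LinearMap.ker_eq_bot']
  simp [sub_eq_zero]

/-! ## Orthogonal complements and linear skew-automorphisms -/

section Orthogonal

variable {K V : Type*} [Field K] [AddCommGroup V] [Module K V] {b : LinearMap.BilinForm K V}

theorem bilin_eq_zero_of_mem_span {s t : Set V} (h : ∀ x ∈ s, ∀ y ∈ t, b x y = 0) :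
    ∀ x ∈ Submodule.span K s, ∀ y ∈ Submodule.span K t, b x y = 0 := by
  intro x hx y hy
  have h_right : ∀ u ∈ s, Submodule.span K t ≤ LinearMap.ker (b u) := fun u hu =>
    Submodule.span_le.2 (h u hu)
  have h_left : Submodule.span K s ≤ LinearMap.ker (b.flip y) :=
    Submodule.span_le.2 fun u hu => h_right u hu hy
  exact h_left hx

theorem isLatticeAut_map (e : V ≃ₗ[K] V) :
    IsLatticeAut (fun U : Submodule K V => U.map (e : V →ₗ[K] V)) :=
  ⟨(Submodule.orderIsoMapComap e).bijective, fun _ _ => (Submodule.orderIsoMapComap e).le_iff_le⟩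

theorem map_orthogonal (b : LinearMap.BilinForm K V) (e : V ≃ₗ[K] V) (U : Submodule K V) :
    (b.orthogonal U).map (e : V →ₗ[K] V) =
      (b.comp LinearMap.id (e.symm : V →ₗ[K] V)).orthogonal U := by
  ext y
  exact Submodule.mem_map_equiv _

theorem orthogonal_map (b : LinearMap.BilinForm K V) (e : V →ₗ[K] V) (U : Submodule K V) :
    b.orthogonal (U.map e) = (b.comp e LinearMap.id).orthogonal U := by
  ext y
  simp only [LinearMap.BilinForm.mem_orthogonal_iff, Submodule.mem_map,
    forall_exists_index, and_imp, forall_apply_eq_imp_iff₂, LinearMap.BilinForm.comp_apply,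
    LinearMap.id_apply]

variable [FiniteDimensional K V]

theorem nondegenerate_comp_equiv (hb : b.Nondegenerate) (e e' : V ≃ₗ[K] V) :
    (b.comp (e : V →ₗ[K] V) (e' : V →ₗ[K] V)).Nondegenerate := by
  refine LinearMap.BilinForm.Nondegenerate.ofSeparatingLeft fun x hx => ?_
  refine e.map_eq_zero_iff.1 (hb.1 _ fun y => ?_)
  simpa using hx (e'.symm y)

theorem orthogonal_flip_orthogonal (hb : b.Nondegenerate) (U : Submodule K V) :
    b.orthogonal (b.flip.orthogonal U) = U := by
  refine (Submodule.eq_of_le_of_finrank_le (fun u hu x hx => hx u hu) ?_).symm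
  have := U.finrank_le
  rw [LinearMap.BilinForm.finrank_orthogonal hb, LinearMap.BilinForm.finrank_orthogonal hb.flip]
  omega

theorem flip_orthogonal_orthogonal (hb : b.Nondegenerate) (U : Submodule K V) :
    b.flip.orthogonal (b.orthogonal U) = U :=
  orthogonal_flip_orthogonal hb.flip U

theorem isLatticeAntiAut_orthogonal (hb : b.Nondegenerate) :
    IsLatticeAntiAut (fun U : Submodule K V => b.orthogonal U) := by
  have hleft : Function.LeftInverse b.flip.orthogonal b.orthogonal := flip_orthogonal_orthogonal hb
  have hright : Function.RightInverse b.flip.orthogonal b.orthogonal :=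
    orthogonal_flip_orthogonal hb
  refine ⟨⟨hleft.injective, hright.surjective⟩, fun U U' => ⟨fun h => ?_,
    LinearMap.BilinForm.orthogonal_le⟩⟩
  rw [← hleft U, ← hleft U']
  exact LinearMap.BilinForm.orthogonal_le h

theorem orthogonal_eq_of_sup_eq_top (hb : b.Nondegenerate) {U U' : Submodule K V}
    (h : ∀ x ∈ U, ∀ y ∈ U', b x y = 0) (htop : U ⊔ U' = ⊤) : b.orthogonal U = U' := by
  have hle : U' ≤ b.orthogonal U := fun y hy x hx => h x hx y hy
  refine (Submodule.eq_of_le_of_finrank_le hle ?_).symm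
  have := Submodule.finrank_add_le_finrank_add_finrank U U'
  rw [htop, finrank_top] at this
  rw [LinearMap.BilinForm.finrank_orthogonal hb]
  omega

theorem exists_map_eq_orthogonal_orthogonal {b' : LinearMap.BilinForm K V} (hb : b.Nondegenerate)
    (hb' : b'.Nondegenerate) :
    ∃ e : V ≃ₗ[K] V, ∀ U, U.map (e : V →ₗ[K] V) = b'.orthogonal (b.orthogonal U) := by
  let e := (b.toDual hb).trans (b'.flip.toDual hb'.flip).symm
  have he : ∀ u x, b'.flip (e u) x = b u x := fun u x =>
    LinearMap.BilinForm.apply_toDual_symm_apply (hB := hb'.flip) (b.toDual hb u) x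
  refine ⟨e, fun U => ?_⟩
  have horth : b.orthogonal U = b'.flip.orthogonal (U.map (e : V →ₗ[K] V)) := by
    rw [orthogonal_map]
    ext x
    exact forall₂_congr fun u _ => by rw [← he]; rfl
  rw [horth, orthogonal_flip_orthogonal hb']

end Orthogonal

section SkewAutomorphism

variable {P K V : Type*} [LE P] [Field K] [AddCommGroup V] [Module K V]

/-- The two kinds of extension that `SkewExtends` is about, with the lattice automorphism of
`Submodule K V` required to come from a linear automorphism of `V`: unlike `SkewExtends` itself,
this property is stable under composition. -/
def LinearlySkewExtends (f : P → Submodule K V) (g : P → P) : Prop :=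
  (IsLatticeAut g ∧ ∃ e : V ≃ₗ[K] V, ∀ w, (f w).map (e : V →ₗ[K] V) = f (g w)) ∨
  (IsLatticeAntiAut g ∧ ∃ b : LinearMap.BilinForm K V, b.Nondegenerate ∧
    ∀ w, b.orthogonal (f w) = f (g w))

variable [FiniteDimensional K V] {f : P → Submodule K V}

theorem LinearlySkewExtends.skewExtends {g : P → P} (hg : LinearlySkewExtends f g) :
    SkewExtends f g := by
  rcases hg with ⟨hg, e, he⟩ | ⟨hg, b, hb, he⟩
  · exact Or.inl ⟨hg, _, isLatticeAut_map e, he⟩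
  · exact Or.inr ⟨b, hb, hg, isLatticeAntiAut_orthogonal hb, he⟩

theorem LinearlySkewExtends.comp {g h : P → P} (hg : LinearlySkewExtends f g)
    (hh : LinearlySkewExtends f h) : LinearlySkewExtends f (g ∘ h) := by
  rcases hg with ⟨hg, e, he⟩ | ⟨hg, b, hb, he⟩ <;>
    rcases hh with ⟨hh, e', he'⟩ | ⟨hh, b', hb', he'⟩
  · refine Or.inl ⟨⟨hg.1.comp hh.1, fun x y => (hg.2 _ _).trans (hh.2 _ _)⟩,
      e'.trans e, fun w => ?_⟩
    rw [Function.comp_apply, ← he, ← he', LinearEquiv.coe_trans, Submodule.map_comp]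
  · refine Or.inr ⟨⟨hg.1.comp hh.1, fun x y => (hg.2 _ _).trans (hh.2 _ _)⟩, _,
      nondegenerate_comp_equiv hb' (LinearEquiv.refl K V) e.symm, fun w => ?_⟩
    rw [Function.comp_apply, ← he, ← he', map_orthogonal]
    rfl
  · refine Or.inr ⟨⟨hg.1.comp hh.1, fun x y => (hg.2 _ _).trans (hh.2 _ _)⟩, _,
      nondegenerate_comp_equiv hb e' (LinearEquiv.refl K V), fun w => ?_⟩
    rw [Function.comp_apply, ← he, ← he', orthogonal_map]
    rfl
  · obtain ⟨e, h⟩ := exists_map_eq_orthogonal_orthogonal hb' hb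
    refine Or.inl ⟨⟨hg.1.comp hh.1, fun x y => (hg.2 _ _).trans (hh.2 _ _)⟩, e, fun w => ?_⟩
    rw [Function.comp_apply, ← he, ← he', h]

theorem LinearlySkewExtends.symm {g : Equiv.Perm P} (hg : LinearlySkewExtends f g) :
    LinearlySkewExtends f g.symm := by
  rcases hg with ⟨hg, e, he⟩ | ⟨hg, b, hb, he⟩
  · refine Or.inl ⟨⟨g.symm.bijective, fun x y => ?_⟩, e.symm, fun w => ?_⟩
    · rw [← hg.2, g.apply_symm_apply, g.apply_symm_apply]
    · conv_lhs => rw [← g.apply_symm_apply w, ← he, ← Submodule.map_comp]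
      simp
  · refine Or.inr ⟨⟨g.symm.bijective, fun x y => ?_⟩, b.flip, hb.flip, fun w => ?_⟩
    · rw [← hg.2, g.apply_symm_apply, g.apply_symm_apply]
    · conv_lhs => rw [← g.apply_symm_apply w, ← he]
      exact flip_orthogonal_orthogonal hb _

/-- The group of the permutations of `P` that are lattice skew-automorphisms and extend linearly to
the lattice of subspaces. -/
def linearSkewAuts (f : P → Submodule K V) : Subgroup (Equiv.Perm P) where
  carrier := {g | LinearlySkewExtends f g}
  mul_mem' hg hh := hg.comp hh
  one_mem' := Or.inl ⟨⟨Function.bijective_id, fun _ _ => Iff.rfl⟩, LinearEquiv.refl K V,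
    fun w => by simp⟩
  inv_mem' hg := hg.symm

end SkewAutomorphism

theorem skewExtends_of_mem_dihedral {B W K V : Type*} [Group W] {M : CoxeterMatrix B}
    {cs : CoxeterSystem M W} [Field K] [AddCommGroup V] [Module K V] [FiniteDimensional K V]
    {c l r : W} (hb : IsBipartition c l r) {f : NC cs c → Submodule K V} {e : V ≃ₗ[K] V}
    (he : ∀ w, (f w).map (e : V →ₗ[K] V) = f (phiLeft cs hb w)) {b : LinearMap.BilinForm K V}
    (hnd : b.Nondegenerate) (hext : ComplementExtends f (kreweras cs c) b)
    {g : Equiv.Perm (NC cs c)} (hg : g ∈ dihedral cs hb) : SkewExtends f g := by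
  suffices hle : dihedral cs hb ≤ linearSkewAuts f from (hle hg).skewExtends
  rw [dihedral, Subgroup.closure_le]
  rintro _ (rfl | rfl)
  · exact Or.inl ⟨isLatticeAut_phiLeft hb, e, he⟩
  · exact Or.inr ⟨hext.1, b, hnd, hext.2.2⟩

/-! ## Products of reflections -/

section ReflectionProduct

variable {ι K V : Type*} [Field K] [AddCommGroup V] [Module K V] {α : ι → V}
  {f : ι → Module.Dual K V} (hα : ∀ i, f i (α i) = 2)

theorem reflection_prod_sub_mem_span (l : List ι) (x : V) :
    (l.map fun i => Module.reflection (hα i)).prod x - x ∈ Submodule.span K (α '' {i | i ∈ l}) := by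
  induction l with
  | nil => simp
  | cons i l ih =>
    simp only [List.map_cons, List.prod_cons, LinearEquiv.mul_apply, Module.reflection_apply,
      sub_right_comm _ _ x]
    refine sub_mem (Submodule.span_mono (Set.image_mono fun j hj => ?_) ih)
      (Submodule.smul_mem _ _ (Submodule.subset_span ⟨i, List.mem_cons_self, rfl⟩))
    exact List.mem_cons_of_mem _ hj

theorem coroot_eq_zero_of_reflection_prod_eq (hli : LinearIndependent K α) {l : List ι}
    (hl : l.Nodup) {x : V} (hx : (l.map fun i => Module.reflection (hα i)).prod x = x) :
    ∀ i ∈ l, f i x = 0 := by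
  induction l with
  | nil => simp
  | cons i l ih =>
    rw [List.nodup_cons] at hl
    have hmem := reflection_prod_sub_mem_span hα l x
    simp only [List.map_cons, List.prod_cons, LinearEquiv.mul_apply, Module.reflection_apply] at hx
    set y := (l.map fun i => Module.reflection (hα i)).prod x
    have hdiff : y - x = f i y • α i := by rw [sub_eq_iff_eq_add, ← sub_eq_iff_eq_add', hx]
    have hcoroot : f i y = 0 := by
      by_contra hne
      rw [hdiff, Submodule.smul_mem_iff _ hne] at hmem
      exact hli.notMem_span_image hl.1 hmem
    have hyx : y = x := by rwa [hcoroot, zero_smul, sub_eq_zero] at hdiff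
    rw [List.forall_mem_cons, ← hyx]
    exact ⟨hcoroot, by rw [hyx]; exact ih hl.2 hyx⟩

end ReflectionProduct

/-! ## Euler forms -/

section EulerForm

variable {R V : Type*} [CommRing R] [AddCommGroup V] [Module R V]

/-- `b` is the bilinear form with `b ((1 - g) x, y) = β (x, y)`. If `β` is the invariant symmetric
form of a reflection group and `g` a Coxeter element, this is the Euler form of the corresponding
quiver. -/
def IsEulerForm (b β : LinearMap.BilinForm R V) (g : V ≃ₗ[R] V) : Prop :=
  ∀ x y, b (x - g x) y = β x y

variable {b β : LinearMap.BilinForm R V} {g : V ≃ₗ[R] V}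

theorem exists_sub_eq_of_movedSpace_eq_top (hg : movedSpace g = ⊤) (x : V) : ∃ y, y - g y = x := by
  obtain ⟨y, hy⟩ : -x ∈ movedSpace g := hg ▸ Submodule.mem_top
  exact ⟨y, by rw [← neg_sub]; exact neg_eq_iff_eq_neg.2 hy⟩

theorem IsEulerForm.conj (hb : IsEulerForm b β g) {h : V ≃ₗ[R] V}
    (hβ : ∀ x y, β (h x) (h y) = β x y) :
    IsEulerForm (b.comp (h.symm : V →ₗ[R] V) (h.symm : V →ₗ[R] V)) β (h * g * h⁻¹) := by
  intro x y
  have hx : h.symm (x - (h * g * h⁻¹) x) = h.symm x - g (h.symm x) := by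
    rw [map_sub]
    exact congrArg _ (h.symm_apply_apply _)
  rw [LinearMap.BilinForm.comp_apply, LinearEquiv.coe_coe, hx, hb, ← hβ, h.apply_symm_apply,
    h.apply_symm_apply]

theorem IsEulerForm.add_swap (hb : IsEulerForm b β g) (hsymm : ∀ x y, β x y = β y x)
    (hβ : ∀ x y, β (g x) (g y) = β x y) (hg : movedSpace g = ⊤) (x y : V) :
    b x y + b y x = β x y := by
  obtain ⟨x, rfl⟩ := exists_sub_eq_of_movedSpace_eq_top hg x
  obtain ⟨y, rfl⟩ := exists_sub_eq_of_movedSpace_eq_top hg y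
  rw [hb, hb]
  simp only [map_sub, LinearMap.sub_apply, hβ, hsymm y]
  abel

/-- If `(1 - uv) z` lies in the moved space of `u`, then `(1 - v) z` lies in both moved spaces, so
`v` fixes `z`. Hence `b ((1 - uv) z, (1 - v) y) = β (z, y) - β (v z, v y) = 0`. -/
theorem IsEulerForm.eq_zero_of_mem_movedSpace {u v : V ≃ₗ[R] V} (hb : IsEulerForm b β (u * v))
    (hβ : ∀ x y, β (v x) (v y) = β x y) (htop : movedSpace (u * v) = ⊤)
    (hdisj : Disjoint (movedSpace u) (movedSpace v)) {x y : V} (hx : x ∈ movedSpace u)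
    (hy : y ∈ movedSpace v) : b x y = 0 := by
  obtain ⟨z, rfl⟩ := exists_sub_eq_of_movedSpace_eq_top htop x
  obtain ⟨y, rfl⟩ := hy
  have hu : v z - z ∈ movedSpace u := by
    have hsplit : v z - z = -(z - (u * v) z) - (u (v z) - v z) := by
      rw [LinearEquiv.mul_apply]; abel
    rw [hsplit]
    exact sub_mem (neg_mem hx) (sub_mem_movedSpace u _)
  have hz : v z = z := sub_eq_zero.1 <|
    Submodule.disjoint_def.1 hdisj _ hu (sub_mem_movedSpace v z)
  change b _ (v y - y) = 0
  rw [hb, map_sub, sub_eq_zero, ← hβ z y, hz]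

/-- Solving `b ((1 - s₁ ⋯ sₙ) x, α k) = ⟨x, α k^∨⟩ d k` one reflection at a time shows that the
triangular form whose symmetrization is `β` is an Euler form of `s₁ ⋯ sₙ`. -/
theorem bilin_sub_reflection_prod {ι K V : Type*} [Field K] [AddCommGroup V] [Module K V]
    {b : LinearMap.BilinForm K V} {α : ι → V} {f : ι → Module.Dual K V}
    (hα : ∀ i, f i (α i) = 2) {d : ι → K} {l : List ι} (hdiag : ∀ i ∈ l, b (α i) (α i) = d i)
    (htri : l.Pairwise fun i j => b (α i) (α j) = 0 ∧ b (α j) (α i) = f i (α j) * d i) (x : V) :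
    ∀ k ∈ l, b (x - (l.map fun i => Module.reflection (hα i)).prod x) (α k) = f k x * d k := by
  induction l with
  | nil => simp
  | cons i l ih =>
    rw [List.pairwise_cons] at htri
    rw [List.forall_mem_cons] at hdiag ⊢
    have hmem := reflection_prod_sub_mem_span hα l x
    simp only [List.map_cons, List.prod_cons, LinearEquiv.mul_apply, Module.reflection_apply]
    set y := (l.map fun i => Module.reflection (hα i)).prod x
    have hsplit : x - (y - f i y • α i) = (x - y) + f i y • α i := by abel
    simp only [hsplit, map_add, LinearMap.add_apply, map_smul, LinearMap.smul_apply, smul_eq_mul]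
    refine ⟨?_, fun k hk => by rw [(htri.1 k hk).1, mul_zero, add_zero, ih hdiag.2 htri.2 k hk]⟩
    have hspan : Submodule.span K (α '' {j | j ∈ l}) ≤
        LinearMap.ker (b.flip (α i) - d i • f i) := by
      rw [Submodule.span_le]
      rintro _ ⟨j, hj, rfl⟩
      change b (α j) (α i) - d i * f i (α j) = 0
      rw [(htri.1 j hj).2, mul_comm, sub_self]
    have hyx : b (y - x) (α i) - d i * f i (y - x) = 0 := hspan hmem
    rw [map_sub, map_sub, LinearMap.sub_apply] at hyx
    rw [map_sub, LinearMap.sub_apply, hdiag.1]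
    linear_combination -hyx

end EulerForm

section FiniteDimensional

variable {K V : Type*} [Field K] [AddCommGroup V] [Module K V] [FiniteDimensional K V]
  {b : LinearMap.BilinForm K V} {g : V ≃ₗ[K] V}

theorem IsEulerForm.nondegenerate {β : LinearMap.BilinForm K V} (hb : IsEulerForm b β g)
    (hβ : β.Nondegenerate) (hg : movedSpace g = ⊤) : b.Nondegenerate := by
  refine LinearMap.BilinForm.Nondegenerate.ofSeparatingLeft fun x hx => ?_
  obtain ⟨y, rfl⟩ := exists_sub_eq_of_movedSpace_eq_top hg x
  rw [hβ.1 y fun z => by rw [← hb]; exact hx z, map_zero, sub_zero]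

theorem exists_isEulerForm (β : LinearMap.BilinForm K V) (hg : movedSpace g = ⊤) :
    ∃ b, IsEulerForm b β g := by
  let F : V →ₗ[K] V := LinearMap.id - (g : V →ₗ[K] V)
  have hF : Function.Injective F := by
    rw [← LinearMap.ker_eq_bot, LinearMap.ker_eq_bot']
    exact fun x hx => movedSpace_eq_top_iff.1 hg x (sub_eq_zero.1 hx).symm
  let e := LinearEquiv.ofInjectiveEndo F hF
  refine ⟨β.comp (e.symm : V →ₗ[K] V) LinearMap.id, fun x y => ?_⟩
  have hx : e.symm (x - g x) = x := e.symm_apply_apply x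
  rw [LinearMap.BilinForm.comp_apply, LinearEquiv.coe_coe, hx, LinearMap.id_apply]

end FiniteDimensional

section Triangular

variable {K V : Type*} [Field K] [AddCommGroup V] [Module K V] {b : LinearMap.BilinForm K V}
  {m : ℕ} {v : Fin m → V}

theorem eq_zero_of_triangular (hlt : ∀ i j, i < j → b (v i) (v j) = 0)
    (hdiag : ∀ i, b (v i) (v i) ≠ 0) {x : Fin m → K} (hx : ∀ j, b (∑ i, x i • v i) (v j) = 0) :
    x = 0 := by
  let G : Matrix (Fin m) (Fin m) K := Matrix.of fun i j => b (v i) (v j)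
  have hdet : G.det ≠ 0 := by
    rw [Matrix.det_of_isLowerTriangular (M := G) hlt]
    exact Finset.prod_ne_zero_iff.2 fun i _ => hdiag i
  refine Matrix.eq_zero_of_vecMul_eq_zero hdet (funext fun j => ?_)
  simpa [G, Matrix.vecMul, dotProduct] using hx j

theorem linearIndependent_of_triangular (hlt : ∀ i j, i < j → b (v i) (v j) = 0)
    (hdiag : ∀ i, b (v i) (v i) ≠ 0) : LinearIndependent K v := by
  rw [Fintype.linearIndependent_iff]
  intro x hx
  exact congrFun (eq_zero_of_triangular hlt hdiag (x := x) fun j => by rw [hx]; simp)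

theorem nondegenerate_of_triangular [FiniteDimensional K V] (hm : m = Module.finrank K V)
    (hlt : ∀ i j, i < j → b (v i) (v j) = 0) (hdiag : ∀ i, b (v i) (v i) ≠ 0) :
    b.Nondegenerate := by
  have hspan := (linearIndependent_of_triangular hlt hdiag).span_eq_top_of_card_eq_finrank'
    (by rw [Fintype.card_fin, hm])
  refine LinearMap.BilinForm.Nondegenerate.ofSeparatingLeft fun x hx => ?_
  have hmem : x ∈ Submodule.span K (Set.range v) := hspan ▸ Submodule.mem_top
  obtain ⟨y, rfl⟩ := (Submodule.mem_span_range_iff_exists_fun K).1 hmem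
  rw [eq_zero_of_triangular hlt hdiag (x := y) fun j => hx (v j)]
  simp

end Triangular

/-! ## The criterion -/

theorem complementExtends_kreweras {B W K V : Type*} [Group W] {M : CoxeterMatrix B}
    {cs : CoxeterSystem M W} [Field K] [AddCommGroup V] [Module K V] [FiniteDimensional K V]
    {c : W} {f : W → Submodule K V} {b : LinearMap.BilinForm K V} (hb : b.Nondegenerate)
    (hsup : ∀ w, AbsLE cs w c → f w ⊔ f (w⁻¹ * c) = ⊤) {R : W → Set V}
    (hspan : ∀ w, AbsLE cs w c → ∀ L, IsReducedFactorization cs L w →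
      f w ≤ Submodule.span K {x | ∃ t ∈ L, x ∈ R t})
    (hR : ∀ s t, Subordinates cs c s t → ∀ x ∈ R s, ∀ y ∈ R t, b x y = 0) :
    ComplementExtends (fun w : NC cs c => f w.1) (kreweras cs c) b := by
  refine ⟨isLatticeAntiAut_kreweras cs c, isLatticeAntiAut_orthogonal hb, fun ⟨w, hw⟩ => ?_⟩
  obtain ⟨L, hL⟩ := exists_isReducedFactorization cs w
  obtain ⟨L', hL'⟩ := exists_isReducedFactorization cs (w⁻¹ * c)
  have hpair := (List.pairwise_append.1 (hL.append hw hL').pairwise_subordinates).2.2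
  refine orthogonal_eq_of_sup_eq_top hb (fun x hx y hy => ?_) (hsup w hw)
  refine bilin_eq_zero_of_mem_span ?_ x (hspan w hw L hL hx) y
    (hspan _ (absLE_kreweras hw) L' hL' hy)
  rintro x ⟨s, hs, hxs⟩ y ⟨t, ht, hyt⟩
  exact hR s t (hpair s hs t ht) x hxs y hyt

/-! ## The geometric representation -/

section GeometricRepresentation

variable {B W : Type*} [Fintype B] [DecidableEq B] [Group W] {M : CoxeterMatrix B}
  {A : Matrix B B ℝ} (cs : CoxeterSystem M W) (hA : IsCartan M A)

theorem refl_apply (i : B) (v : B → ℝ) : refl hA i v = v - coroot A i v • simpleRoot i :=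
  Module.reflection_apply _ _

theorem geomRep_simple (i : B) : geomRep cs hA (cs.simple i) = refl hA i :=
  cs.lift_apply_simple _ i

theorem geomRep_wordProd (l : List B) : geomRep cs hA (cs.wordProd l) =
    (l.map fun i => Module.reflection (coroot_self hA i)).prod := by
  rw [CoxeterSystem.wordProd, map_list_prod, List.map_map]
  exact congrArg (fun F => (l.map F).prod) (funext (geomRep_simple cs hA))

theorem geomRep_mul_apply (u v : W) (x : B → ℝ) :
    geomRep cs hA (u * v) x = geomRep cs hA u (geomRep cs hA v x) := by
  rw [map_mul, LinearEquiv.mul_apply]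

omit [Fintype B] in
theorem linearIndependent_simpleRoot [Finite B] :
    LinearIndependent ℝ (simpleRoot : B → B → ℝ) := by
  rw [show (simpleRoot : B → B → ℝ) = Pi.basisFun ℝ B from
    funext fun i => (Pi.basisFun_apply ℝ B i).symm]
  exact (Pi.basisFun ℝ B).linearIndependent

theorem eq_zero_of_coroot_eq_zero (hdet : A.det ≠ 0) {v : B → ℝ} (hv : ∀ i, coroot A i v = 0) :
    v = 0 :=
  Matrix.eq_zero_of_vecMul_eq_zero hdet (funext hv)

-- A vector `v` that is fixed by `W` is `0`: the sum over `W` is `|W| • v` at `v`, but it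
-- vanishes at every simple root, since the simple reflection changes the sign of the root.
theorem det_ne_zero_of_finite [Finite W] (cs : CoxeterSystem M W) (hA : IsCartan M A) :
    A.det ≠ 0 := by
  intro hdet
  obtain ⟨v, hv0, hv⟩ := Matrix.exists_vecMul_eq_zero_iff.2 hdet
  have := Fintype.ofFinite W
  have hfix : ∀ w, geomRep cs hA w v = v := fun w => by
    induction w using cs.simple_induction_left with
    | one => simp
    | mul_simple_left w i ih =>
      have hcoroot : coroot A i v = 0 := congrFun hv i
      rw [geomRep_mul_apply, ih, geomRep_simple, refl_apply, hcoroot, zero_smul, sub_zero]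
  let P : (B → ℝ) →ₗ[ℝ] (B → ℝ) := ∑ w : W, (geomRep cs hA w : (B → ℝ) →ₗ[ℝ] (B → ℝ))
  have hP : ∀ x, P x = ∑ w : W, geomRep cs hA w x := fun x => by simp [P]
  have hroot : ∀ i, P (Pi.basisFun ℝ B i) = 0 := fun i => by
    rw [Pi.basisFun_apply, ← simpleRoot]
    refine self_eq_neg.1 ?_
    conv_lhs => rw [hP, ← Equiv.sum_comp (Equiv.mulRight (cs.simple i))]
    simp only [Equiv.coe_mulRight, geomRep_mul_apply, geomRep_simple, refl,
      Module.reflection_apply_self, map_neg, Finset.sum_neg_distrib, hP]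
  have hPv : P v = Fintype.card W • v := by simp [hP, hfix]
  rw [show P = 0 from (Pi.basisFun ℝ B).ext hroot, LinearMap.zero_apply] at hPv
  exact hv0 ((smul_eq_zero.1 hPv.symm).resolve_left Fintype.card_ne_zero)

theorem mov_eq_movedSpace (w : W) : mov cs hA w = movedSpace (geomRep cs hA w) :=
  rfl

theorem mov_mul_le (u v : W) : mov cs hA (u * v) ≤ mov cs hA u ⊔ mov cs hA v := by
  simpa only [mov_eq_movedSpace, map_mul] using movedSpace_mul_le _ _

theorem mov_conj (u w : W) :
    mov cs hA (u * w * u⁻¹) = (mov cs hA w).map (geomRep cs hA u : (B → ℝ) →ₗ[ℝ] (B → ℝ)) := by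
  rw [mov_eq_movedSpace, map_mul, map_mul, map_inv, movedSpace_conj, mov_eq_movedSpace]

theorem mov_inv (w : W) : mov cs hA w⁻¹ = mov cs hA w := by
  rw [mov_eq_movedSpace, map_inv, movedSpace_inv, mov_eq_movedSpace]

theorem mov_prod_le (L : List W) : mov cs hA L.prod ≤ ⨆ t ∈ L, mov cs hA t := by
  simpa only [mov_eq_movedSpace, map_list_prod, List.mem_map, iSup_exists, iSup_and,
    iSup_comm (ι := W ≃* W), iSup_comm (ι := (B → ℝ) ≃ₗ[ℝ] (B → ℝ)), iSup_iSup_eq_right]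
    using movedSpace_list_prod_le (L.map (geomRep cs hA))

theorem exists_isRootOf {t : W} (ht : cs.IsReflection t) : ∃ v, IsRootOf cs hA t v := by
  obtain ⟨u, i, h⟩ := ht
  exact ⟨_, u, i, h, rfl⟩

variable {cs hA}

theorem mov_eq_span_root {t : W} {v : B → ℝ} (hv : IsRootOf cs hA t v) :
    mov cs hA t = Submodule.span ℝ {v} := by
  obtain ⟨u, i, rfl, rfl⟩ := hv
  rw [mov_conj, mov_eq_movedSpace, geomRep_simple, refl, movedSpace_reflection,
    Submodule.map_span, Set.image_singleton, LinearEquiv.coe_coe]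

theorem IsRootOf.mem_mov {t : W} {v : B → ℝ} (hv : IsRootOf cs hA t v) : v ∈ mov cs hA t :=
  mov_eq_span_root hv ▸ Submodule.mem_span_singleton_self v

variable (cs hA)

theorem finrank_iSup_mov_le {L : List W} (hL : ∀ t ∈ L, cs.IsReflection t) :
    Module.finrank ℝ (⨆ t ∈ L, mov cs hA t : Submodule ℝ (B → ℝ)) ≤ L.length := by
  induction L with
  | nil => simp
  | cons t L ih =>
    rw [List.forall_mem_cons] at hL
    obtain ⟨v, hv⟩ := exists_isRootOf cs hA hL.1
    have ht : Module.finrank ℝ (mov cs hA t) ≤ 1 := by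
      rw [mov_eq_span_root hv]
      exact (finrank_span_le_card _).trans (by simp)
    have hsup : (⨆ r ∈ t :: L, mov cs hA r) = mov cs hA t ⊔ ⨆ r ∈ L, mov cs hA r := by
      simp only [List.mem_cons, iSup_or, iSup_sup_eq, iSup_iSup_eq_left]
    rw [hsup, List.length_cons, add_comm]
    exact (Submodule.finrank_add_le_finrank_add_finrank _ _).trans (add_le_add ht (ih hL.2))

theorem finrank_mov_le_absLength (w : W) :
    Module.finrank ℝ (mov cs hA w) ≤ absLength cs w := by
  obtain ⟨L, hL, rfl, hlen⟩ := exists_isReducedFactorization cs w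
  rw [← hlen]
  exact (Submodule.finrank_mono (mov_prod_le cs hA L)).trans (finrank_iSup_mov_le cs hA hL)

variable {c : W}

theorem mov_coxeterElement (hdet : A.det ≠ 0) (hc : IsCoxeterElement cs c) :
    mov cs hA c = ⊤ := by
  obtain ⟨l, hl, hmem, w, rfl⟩ := hc
  rw [mov_conj, mov_eq_movedSpace, movedSpace_eq_top_iff.2, Submodule.map_top]
  · exact LinearEquiv.range _
  · intro x hx
    rw [geomRep_wordProd] at hx
    exact eq_zero_of_coroot_eq_zero hdet fun i =>
      coroot_eq_zero_of_reflection_prod_eq _ linearIndependent_simpleRoot hl hx i (hmem i)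

omit [DecidableEq B] in
theorem absLength_coxeterElement_le (hc : IsCoxeterElement cs c) :
    absLength cs c ≤ Fintype.card B := by
  obtain ⟨l, hl, -, w, rfl⟩ := hc
  rw [absLength_conj]
  refine (absLength_prod_le cs ?_).trans ?_
  · simp only [List.mem_map, forall_exists_index, and_imp, forall_apply_eq_imp_iff₂]
    exact fun i _ => cs.isReflection_simple i
  · rw [List.length_map]
    exact hl.length_le_card

theorem absLength_coxeterElement (hA : IsCartan M A) (hdet : A.det ≠ 0)
    (hc : IsCoxeterElement cs c) : absLength cs c = Fintype.card B := by
  refine le_antisymm (absLength_coxeterElement_le cs hc) ?_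
  have := finrank_mov_le_absLength cs hA c
  rwa [mov_coxeterElement cs hA hdet hc, finrank_top, Module.finrank_fintype_fun_eq_card] at this

variable {cs hA}

theorem mov_sup_mov_eq_top (hm : mov cs hA c = ⊤) (w : W) :
    mov cs hA w ⊔ mov cs hA (w⁻¹ * c) = ⊤ := by
  rw [eq_top_iff, ← hm]
  simpa only [mul_inv_cancel_left] using mov_mul_le cs hA w (w⁻¹ * c)

theorem complementExtends_mov (hm : mov cs hA c = ⊤) {b : LinearMap.BilinForm ℝ (B → ℝ)}
    (hb : b.Nondegenerate)
    (h : ∀ s t, Subordinates cs c s t → ∀ u v, IsRootOf cs hA s u → IsRootOf cs hA t v →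
      b u v = 0) :
    ComplementExtends (fun w : NC cs c => mov cs hA w.1) (kreweras cs c) b := by
  refine complementExtends_kreweras (R := fun t => {v | IsRootOf cs hA t v}) hb
    (fun w _ => mov_sup_mov_eq_top hm w) (fun w _ L hL => ?_)
    fun s t hst u hu v hv => h s t hst u v hu hv
  obtain ⟨hrefl, rfl, -⟩ := hL
  refine (mov_prod_le cs hA L).trans (iSup₂_le fun t ht => ?_)
  obtain ⟨v, hv⟩ := exists_isRootOf cs hA (hrefl t ht)
  rw [mov_eq_span_root hv, Submodule.span_singleton_le_iff_mem]
  exact Submodule.subset_span ⟨t, ht, hv⟩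

/-- The spaces `mov w` and `mov (w⁻¹ c)` have sum `V`, so the bounds `dim mov w ≤ ℓ w` and
`dim mov (w⁻¹ c) ≤ ℓ (w⁻¹ c)`, whose right hand sides add up to `dim V`, are sharp. -/
theorem finrank_mov_eq_absLength (hm : mov cs hA c = ⊤) (hlen : absLength cs c = Fintype.card B)
    {w : W} (hw : AbsLE cs w c) : Module.finrank ℝ (mov cs hA w) = absLength cs w := by
  have hsum := Submodule.finrank_add_le_finrank_add_finrank (mov cs hA w) (mov cs hA (w⁻¹ * c))
  rw [mov_sup_mov_eq_top hm, finrank_top, Module.finrank_fintype_fun_eq_card] at hsum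
  have := finrank_mov_le_absLength cs hA w
  have := finrank_mov_le_absLength cs hA (w⁻¹ * c)
  unfold AbsLE at hw
  omega

theorem disjoint_mov_mov (hm : mov cs hA c = ⊤) (hlen : absLength cs c = Fintype.card B)
    {w : W} (hw : AbsLE cs w c) : Disjoint (mov cs hA w) (mov cs hA (w⁻¹ * c)) := by
  have hsum := Submodule.finrank_sup_add_finrank_inf_eq (mov cs hA w) (mov cs hA (w⁻¹ * c))
  rw [mov_sup_mov_eq_top hm, finrank_top, Module.finrank_fintype_fun_eq_card,
    finrank_mov_eq_absLength hm hlen hw, finrank_mov_eq_absLength hm hlen (absLE_kreweras hw),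
    ← hw, hlen] at hsum
  exact disjoint_iff.2 (Submodule.finrank_eq_zero.1 (by omega))

theorem mov_eq_iSup (hm : mov cs hA c = ⊤) (hlen : absLength cs c = Fintype.card B) {w : W}
    {L : List W} (hw : AbsLE cs w c) (hL : IsReducedFactorization cs L w) :
    mov cs hA w = ⨆ t ∈ L, mov cs hA t := by
  refine Submodule.eq_of_le_of_finrank_le (hL.prod_eq ▸ mov_prod_le cs hA L) ?_
  rw [finrank_mov_eq_absLength hm hlen hw, ← hL.length_eq]
  exact finrank_iSup_mov_le cs hA hL.isReflection

theorem IsEulerForm.root_eq_zero {b β : LinearMap.BilinForm ℝ (B → ℝ)}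
    (hb : IsEulerForm b β (geomRep cs hA c))
    (hβ : ∀ w x y, β (geomRep cs hA w x) (geomRep cs hA w y) = β x y)
    (hm : mov cs hA c = ⊤) (hlen : absLength cs c = Fintype.card B) {s t : W}
    (hst : Subordinates cs c s t) {u v : B → ℝ} (hu : IsRootOf cs hA s u)
    (hv : IsRootOf cs hA t v) : b u v = 0 := by
  obtain ⟨L, hL⟩ := hst.exists_isReducedFactorization
  have hs : AbsLE cs s c := by simpa using (hL.of_sublist (L' := [s]) (by simp)).2
  obtain ⟨htL, htc⟩ := hL.of_sublist (List.sublist_cons_self s (t :: L))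
  have hprod : s⁻¹ * c = (t :: L).prod := by
    rw [← hL.prod_eq, List.prod_cons, inv_mul_cancel_left]
  have hv' : v ∈ mov cs hA (s⁻¹ * c) := by
    rw [hprod, mov_eq_iSup hm hlen htc htL]
    exact le_iSup₂_of_le (f := fun r _ => mov cs hA r) t (by simp) le_rfl hv.mem_mov
  have hcomp : geomRep cs hA s * geomRep cs hA (s⁻¹ * c) = geomRep cs hA c := by
    rw [← map_mul, mul_inv_cancel_left]
  rw [← hcomp] at hb
  exact hb.eq_zero_of_mem_movedSpace (hβ _) (hcomp ▸ hm) (disjoint_mov_mov hm hlen hs)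
    hu.mem_mov hv'

end GeometricRepresentation

/-! ## The invariant form -/

section CartanForm

variable {B W : Type*} [Fintype B] [DecidableEq B] [Group W] {M : CoxeterMatrix B}
  {A : Matrix B B ℝ} {d : B → ℝ}

/-- The bilinear form with values `A i j * d j` on the simple roots. If `d` symmetrizes `A`, it is
the invariant form for which the simple root `α i` has squared length `2 * d i`. -/
noncomputable def cartanForm (A : Matrix B B ℝ) (d : B → ℝ) : LinearMap.BilinForm ℝ (B → ℝ) :=
  Matrix.toBilin' (A * Matrix.diagonal d)

theorem cartanForm_simpleRoot (x : B → ℝ) (j : B) :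
    cartanForm A d x (simpleRoot j) = coroot A j x * d j := by
  simp [cartanForm, simpleRoot, coroot, Matrix.toBilin'_apply', Matrix.vecMul, dotProduct,
    Finset.sum_mul, mul_assoc]

theorem cartanForm_comm (hd : ∀ i j, A i j * d j = A j i * d i) (x y : B → ℝ) :
    cartanForm A d x y = cartanForm A d y x := by
  have hA : (A * Matrix.diagonal d).IsSymm := Matrix.ext fun i j => by
    simpa only [Matrix.transpose_apply, Matrix.mul_diagonal] using hd j i
  rw [cartanForm, Matrix.toBilin'_apply', Matrix.toBilin'_apply', Matrix.dotProduct_mulVec,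
    dotProduct_comm, ← Matrix.mulVec_transpose, hA]

theorem cartanForm_nondegenerate (hdet : A.det ≠ 0) (hd : ∀ i, d i ≠ 0) :
    (cartanForm A d).Nondegenerate := by
  refine LinearMap.BilinForm.Nondegenerate.ofSeparatingLeft fun x hx =>
    eq_zero_of_coroot_eq_zero hdet fun i => ?_
  have := hx (simpleRoot i)
  rw [cartanForm_simpleRoot] at this
  exact (mul_eq_zero.1 this).resolve_right (hd i)

variable (cs : CoxeterSystem M W) (hA : IsCartan M A)

theorem cartanForm_geomRep (hd : ∀ i j, A i j * d j = A j i * d i) (w : W) (x y : B → ℝ) :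
    cartanForm A d (geomRep cs hA w x) (geomRep cs hA w y) = cartanForm A d x y := by
  induction w using cs.simple_induction_left with
  | one => simp
  | mul_simple_left w i ih =>
    rw [geomRep_mul_apply, geomRep_mul_apply, ← ih, geomRep_simple, refl_apply, refl_apply]
    simp only [map_sub, map_smul, LinearMap.sub_apply, LinearMap.smul_apply, cartanForm_simpleRoot,
      smul_eq_mul, coroot_self hA]
    rw [cartanForm_comm hd (simpleRoot i), cartanForm_simpleRoot]
    ring

variable {cs hA} {c : W} {b : LinearMap.BilinForm ℝ (B → ℝ)}

theorem IsEulerForm.exists_root_self (hb : IsEulerForm b (cartanForm A d) (geomRep cs hA c))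
    (hd : ∀ i j, A i j * d j = A j i * d i) (hm : mov cs hA c = ⊤) {t : W} {v : B → ℝ}
    (hv : IsRootOf cs hA t v) : ∃ i, b v v = d i := by
  have h := hb.add_swap (cartanForm_comm hd) (cartanForm_geomRep cs hA hd c) hm v v
  obtain ⟨u, i, -, rfl⟩ := hv
  rw [cartanForm_geomRep cs hA hd, cartanForm_simpleRoot, coroot_self hA] at h
  exact ⟨i, by linarith⟩

end CartanForm

/-! ## Reduction modulo a prime -/

section IntegralVectors

variable {B : Type*} [Fintype B] [DecidableEq B]

theorem mem_span_rows_iff {F : Type*} [Field F] {R : Matrix B B F} (hdet : R.det ≠ 0) {s : Set B}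
    {x : B → F} :
    x ∈ Submodule.span F (R.row '' s) ↔ ∀ k ∉ s, Matrix.vecMul x R.adjugate k = 0 := by
  refine ⟨fun hx k hk => ?_, fun hx => ?_⟩
  · have hle : Submodule.span F (R.row '' s) ≤
        LinearMap.ker (LinearMap.proj k ∘ₗ R.adjugate.vecMulLinear) := by
      rw [Submodule.span_le]
      rintro _ ⟨i, hi, rfl⟩
      change (R * R.adjugate) i k = 0
      rw [Matrix.mul_adjugate, Matrix.smul_apply, Matrix.one_apply_ne (ne_of_mem_of_not_mem hi hk),
        smul_zero]
    exact hle hx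
  · have hvec : R.det • x = Matrix.vecMul (Matrix.vecMul x R.adjugate) R := by
      rw [Matrix.vecMul_vecMul, Matrix.adjugate_mul, Matrix.vecMul_smul, Matrix.vecMul_one]
    have hsum : R.det • x = ∑ k, Matrix.vecMul x R.adjugate k • R.row k :=
      hvec.trans (Matrix.vecMul_eq_sum _ _)
    rw [← Submodule.smul_mem_iff _ hdet, hsum]
    refine Submodule.sum_mem _ fun k _ => ?_
    by_cases hk : k ∈ s
    · exact Submodule.smul_mem _ _ (Submodule.subset_span ⟨k, hk, rfl⟩)
    · rw [hx k hk, zero_smul]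
      exact Submodule.zero_mem _

theorem vecMul_adjugate_intCast {F : Type*} [CommRing F] (R : Matrix B B ℤ) (z : B → ℤ) (k : B) :
    Matrix.vecMul (fun k => (z k : F)) (R.map (Int.cast : ℤ → F)).adjugate k =
      (Matrix.vecMul z R.adjugate k : ℤ) := by
  rw [← eq_intCast (Int.castRingHom F) (Matrix.vecMul z _ k), RingHom.map_vecMul,
    ← RingHom.mapMatrix_apply, RingHom.map_adjugate]
  rfl

theorem intCast_mem_span_rows {K : Type*} [Field K] {R : Matrix B B ℤ} (hdet : (R.det : K) ≠ 0)
    {s : Set B} {z : B → ℤ}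
    (hz : (fun k => (z k : ℝ)) ∈ Submodule.span ℝ ((R.map (Int.cast : ℤ → ℝ)).row '' s)) :
    (fun k => (z k : K)) ∈ Submodule.span K ((R.map (Int.cast : ℤ → K)).row '' s) := by
  have hdet0 : (R.det : ℝ) ≠ 0 := Int.cast_ne_zero.2 fun h => hdet (by rw [h, Int.cast_zero])
  rw [mem_span_rows_iff (by rwa [← Int.cast_det])] at hz ⊢
  intro k hk
  have hzk := hz k hk
  rw [vecMul_adjugate_intCast, Int.cast_eq_zero] at hzk
  rw [vecMul_adjugate_intCast, hzk, Int.cast_zero]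

omit [DecidableEq B] in
theorem intCast_mem_span_of_mem_span {ι K : Type*} [Fintype ι] [Field K]
    (hcard : Fintype.card ι = Fintype.card B) {v : ι → B → ℤ}
    (hli : LinearIndependent K (fun i k => (v i k : K))) {s : Set ι} {z : B → ℤ}
    (hz : (fun k => (z k : ℝ)) ∈ Submodule.span ℝ ((fun i k => (v i k : ℝ)) '' s)) :
    (fun k => (z k : K)) ∈ Submodule.span K ((fun i k => (v i k : K)) '' s) := by
  classical
  let e : B ≃ ι := Fintype.equivOfCardEq hcard.symm
  let R : Matrix B B ℤ := Matrix.of fun k => v (e k)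
  have hdet : (R.det : K) ≠ 0 := by
    have hrow : LinearIndependent K (R.map (Int.cast : ℤ → K)).row := hli.comp e e.injective
    rw [Matrix.linearIndependent_rows_iff_isUnit, Matrix.isUnit_iff_isUnit_det] at hrow
    rw [Int.cast_det]
    exact hrow.ne_zero
  rw [← e.image_preimage s, Set.image_image] at hz ⊢
  exact intCast_mem_span_rows hdet hz

theorem toLin'_intCast (F : Type*) [CommRing F] (Z : Matrix B B ℤ) (z : B → ℤ) :
    Matrix.toLin' (Z.map (Int.cast : ℤ → F)) (fun k => (z k : F)) =
      fun k => ((Matrix.mulVec Z z k : ℤ) : F) := by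
  ext k
  exact ((Int.castRingHom F).map_mulVec Z z k).symm

theorem toLin'_comp_toLin'_intCast {F : Type*} [CommRing F] {Z Z' : Matrix B B ℤ}
    (h : Z * Z' = 1) :
    Matrix.toLin' (Z.map (Int.cast : ℤ → F)) ∘ₗ Matrix.toLin' (Z'.map (Int.cast : ℤ → F)) =
      LinearMap.id := by
  have hmap : Z.map (Int.cast : ℤ → F) * Z'.map (Int.cast : ℤ → F) = 1 := by
    have := congrArg (Int.castRingHom F).mapMatrix h
    rwa [map_mul, map_one] at this
  rw [← Matrix.toLin'_mul, hmap, Matrix.toLin'_one]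

theorem map_reduceSubspace_le (p : ℕ) (Z : Matrix B B ℤ) (U : Submodule ℝ (B → ℝ)) :
    (reduceSubspace p U).map (Matrix.toLin' (Z.map (Int.cast : ℤ → ZMod p))) ≤
      reduceSubspace p (U.map (Matrix.toLin' (Z.map (Int.cast : ℤ → ℝ)))) := by
  rw [reduceSubspace, Submodule.map_span, Submodule.span_le]
  rintro _ ⟨_, ⟨z, hz, rfl⟩, rfl⟩
  exact Submodule.subset_span ⟨Matrix.mulVec Z z, ⟨_, hz, toLin'_intCast ℝ Z z⟩,
    toLin'_intCast (ZMod p) Z z⟩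

theorem map_reduceSubspace (p : ℕ) {Z Z' : Matrix B B ℤ} (h : Z * Z' = 1)
    (U : Submodule ℝ (B → ℝ)) :
    (reduceSubspace p U).map (Matrix.toLin' (Z.map (Int.cast : ℤ → ZMod p))) =
      reduceSubspace p (U.map (Matrix.toLin' (Z.map (Int.cast : ℤ → ℝ)))) := by
  refine le_antisymm (map_reduceSubspace_le p Z U) ?_
  have hle := Submodule.map_mono (f := Matrix.toLin' (Z.map (Int.cast : ℤ → ZMod p)))
    (map_reduceSubspace_le p Z' (U.map (Matrix.toLin' (Z.map (Int.cast : ℤ → ℝ)))))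
  rwa [← Submodule.map_comp, ← Submodule.map_comp, toLin'_comp_toLin'_intCast h,
    toLin'_comp_toLin'_intCast (mul_eq_one_comm.1 h), Submodule.map_id, Submodule.map_id] at hle

end IntegralVectors

section Prime

variable {B W : Type*} [Fintype B] [DecidableEq B] [Group W] {M : CoxeterMatrix B}
  {A : Matrix B B ℤ} (cs : CoxeterSystem M W) (hA : IsCartan M (A.map (Int.cast : ℤ → ℝ)))

theorem refl_eq_toLin' (i : B) : (refl hA i : (B → ℝ) →ₗ[ℝ] (B → ℝ)) = Matrix.toLin'
    ((1 - Matrix.vecMulVec (Pi.single i 1) (A.col i) : Matrix B B ℤ).map (Int.cast : ℤ → ℝ)) := by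
  ext j k
  simp [refl_apply, coroot, simpleRoot, Matrix.vecMulVec_apply, Matrix.one_apply, Pi.single_apply]

theorem exists_intMatrix_geomRep : ∃ ρ : W →* Matrix B B ℤ, ∀ w,
    (geomRep cs hA w : (B → ℝ) →ₗ[ℝ] (B → ℝ)) =
      Matrix.toLin' ((ρ w).map (Int.cast : ℤ → ℝ)) := by
  let F : Matrix B B ℤ →+* Module.End ℝ (B → ℝ) :=
    (Matrix.toLinAlgEquiv' : Matrix B B ℝ ≃ₐ[ℝ] _).toRingEquiv.toRingHom.comp
      (Int.castRingHom ℝ).mapMatrix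
  have hF : Function.Injective F :=
    Matrix.toLinAlgEquiv'.injective.comp (Matrix.map_injective Int.cast_injective)
  have hgeom : ∀ w, ∃ Z, (geomRep cs hA w : (B → ℝ) →ₗ[ℝ] (B → ℝ)) = F Z := fun w => by
    induction w using cs.simple_induction_left with
    | one => exact ⟨1, by rw [map_one, map_one]; rfl⟩
    | mul_simple_left w i ih =>
      obtain ⟨Z, hZ⟩ := ih
      refine ⟨(1 - Matrix.vecMulVec (Pi.single i 1) (A.col i)) * Z, ?_⟩
      rw [map_mul, map_mul, geomRep_simple, ← hZ]
      exact congrArg (· ∘ₗ _) (refl_eq_toLin' hA i)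
  choose ρ hρ using hgeom
  refine ⟨⟨⟨ρ, hF ?_⟩, fun u v => hF ?_⟩, hρ⟩
  · rw [← hρ, map_one, map_one]
    rfl
  · rw [← hρ, map_mul, map_mul, ← hρ, ← hρ]
    rfl

theorem exists_isIntRootOf {t : W} (ht : cs.IsReflection t) : ∃ z, IsIntRootOf cs hA t z := by
  obtain ⟨u, i, h⟩ := ht
  obtain ⟨ρ, hρ⟩ := exists_intMatrix_geomRep cs hA
  refine ⟨(ρ u).col i, u, i, h, ?_⟩
  rw [← LinearEquiv.coe_coe, hρ, simpleRoot, Matrix.toLin'_apply, Matrix.mulVec_single_one]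
  rfl

theorem exists_map_movP_eq_conj (p : ℕ) (u : W) :
    ∃ e : (B → ZMod p) ≃ₗ[ZMod p] (B → ZMod p), ∀ w,
      (movP cs hA p w).map (e : (B → ZMod p) →ₗ[ZMod p] (B → ZMod p)) =
        movP cs hA p (u * w * u⁻¹) := by
  obtain ⟨ρ, hρ⟩ := exists_intMatrix_geomRep cs hA
  have hmul : ρ u * ρ u⁻¹ = 1 := by rw [← map_mul, mul_inv_cancel, map_one]
  refine ⟨LinearEquiv.ofLinearMap _ _ (toLin'_comp_toLin'_intCast hmul)
    (toLin'_comp_toLin'_intCast (mul_eq_one_comm.1 hmul)), fun w => ?_⟩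
  rw [movP, movP, mov_conj, hρ]
  exact map_reduceSubspace p hmul _

variable {cs hA} {c : W}

variable (cs hA c) in
/-- Over `K` the integral roots of every reduced factorization of `c` are linearly independent.
This is the part of the compatibility condition that the criterion depends on. -/
def CompatibleAt (K : Type*) [Field K] : Prop :=
  ∀ L, IsReducedFactorization cs L c → ∀ v : Fin L.length → B → ℤ,
    (∀ i, IsIntRootOf cs hA (L.get i) (v i)) → LinearIndependent K fun i k => (v i k : K)

theorem compatibleAt_real (hm : mov cs hA c = ⊤) (hlen : absLength cs c = Fintype.card B) :
    CompatibleAt cs hA c ℝ := by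
  intro L hL v hv
  refine linearIndependent_of_top_le_span_of_card_eq_finrank ?_
    (by rw [Fintype.card_fin, hL.length_eq, hlen, Module.finrank_fintype_fun_eq_card])
  rw [← hm, ← hL.prod_eq]
  refine (mov_prod_le cs hA L).trans (iSup₂_le fun t ht => ?_)
  obtain ⟨i, rfl⟩ := List.mem_iff_get.1 ht
  rw [mov_eq_span_root (hv i), Submodule.span_singleton_le_iff_mem]
  exact Submodule.subset_span ⟨i, rfl⟩

theorem CompatibleAt.of_compatible {p : ℕ} [Fact p.Prime] (hp : Compatible cs hA p)
    (hm : mov cs hA c = ⊤) (hlen : absLength cs c = Fintype.card B) :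
    CompatibleAt cs hA c (ZMod p) := by
  intro L hL v hv
  let e : B ≃ Fin L.length :=
    Fintype.equivOfCardEq (by rw [Fintype.card_fin, hL.length_eq, hlen])
  have hli := hp (fun k => v (e k)) (fun k => ⟨_, hv (e k)⟩)
    ((compatibleAt_real hm hlen L hL v hv).comp e e.injective)
  exact (linearIndependent_equiv e).1 hli

theorem IsIntRootOf.intCast_mem_movP (p : ℕ) {L : List W} {w : W}
    (hw : mov cs hA w = ⨆ t ∈ L, mov cs hA t) {t : W} (ht : t ∈ L) {z : B → ℤ}
    (hz : IsIntRootOf cs hA t z) : (fun k => (z k : ZMod p)) ∈ movP cs hA p w :=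
  Submodule.subset_span ⟨z, hw ▸ Submodule.mem_iSup_of_mem t
    (Submodule.mem_iSup_of_mem ht (IsRootOf.mem_mov hz)), rfl⟩

theorem movP_sup_movP_eq_top {p : ℕ} [Fact p.Prime] (hp : CompatibleAt cs hA c (ZMod p))
    (hm : mov cs hA c = ⊤) (hlen : absLength cs c = Fintype.card B) {w : W} (hw : AbsLE cs w c) :
    movP cs hA p w ⊔ movP cs hA p (w⁻¹ * c) = ⊤ := by
  obtain ⟨L, hL⟩ := exists_isReducedFactorization cs w
  obtain ⟨L', hL'⟩ := exists_isReducedFactorization cs (w⁻¹ * c)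
  have happ := hL.append hw hL'
  choose v hv using fun i => exists_isIntRootOf cs hA (happ.isReflection _ ((L ++ L').get_mem i))
  rw [eq_top_iff, ← (hp _ happ v hv).span_eq_top_of_card_eq_finrank'
    (by rw [Fintype.card_fin, happ.length_eq, hlen, Module.finrank_fintype_fun_eq_card]),
    Submodule.span_le]
  rintro _ ⟨i, rfl⟩
  rcases List.mem_append.1 ((L ++ L').get_mem i) with hi | hi
  · exact Submodule.mem_sup_left ((hv i).intCast_mem_movP p (mov_eq_iSup hm hlen hw hL) hi)
  · exact Submodule.mem_sup_right
      ((hv i).intCast_mem_movP p (mov_eq_iSup hm hlen (absLE_kreweras hw) hL') hi)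

theorem movP_le_span {p : ℕ} [Fact p.Prime] (hp : CompatibleAt cs hA c (ZMod p))
    (hm : mov cs hA c = ⊤) (hlen : absLength cs c = Fintype.card B) {w : W} (hw : AbsLE cs w c)
    {L : List W} (hL : IsReducedFactorization cs L w) :
    movP cs hA p w ≤ Submodule.span (ZMod p)
      {x | ∃ t ∈ L, ∃ z, IsIntRootOf cs hA t z ∧ x = fun k => (z k : ZMod p)} := by
  obtain ⟨L', hL'⟩ := exists_isReducedFactorization cs (w⁻¹ * c)
  have happ := hL.append hw hL'
  choose v hv using fun i => exists_isIntRootOf cs hA (happ.isReflection _ ((L ++ L').get_mem i))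
  have hmov : mov cs hA w ≤
      Submodule.span ℝ ((fun i k => (v i k : ℝ)) '' {i | (L ++ L').get i ∈ L}) := by
    rw [mov_eq_iSup hm hlen hw hL]
    refine iSup₂_le fun t ht => ?_
    obtain ⟨i, rfl⟩ := List.mem_iff_get.1 (List.mem_append_left L' ht)
    rw [mov_eq_span_root (hv i), Submodule.span_singleton_le_iff_mem]
    exact Submodule.subset_span ⟨i, ht, rfl⟩
  refine Submodule.span_le.2 ?_
  rintro _ ⟨z, hz, rfl⟩
  refine Submodule.span_mono ?_ (intCast_mem_span_of_mem_span
    (by rw [Fintype.card_fin, happ.length_eq, hlen]) (hp _ happ v hv) (hmov hz))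
  rintro _ ⟨i, hi, rfl⟩
  exact ⟨_, hi, _, hv i, rfl⟩

theorem complementExtends_movP {p : ℕ} [Fact p.Prime] (hp : CompatibleAt cs hA c (ZMod p))
    (hm : mov cs hA c = ⊤) (hlen : absLength cs c = Fintype.card B)
    {b : LinearMap.BilinForm (ZMod p) (B → ZMod p)} (hb : b.Nondegenerate)
    (h : ∀ s t, Subordinates cs c s t → ∀ u v : B → ℤ,
      IsIntRootOf cs hA s u → IsIntRootOf cs hA t v →
        b (fun i => (u i : ZMod p)) (fun i => (v i : ZMod p)) = 0) :
    ComplementExtends (fun w : NC cs c => movP cs hA p w.1) (kreweras cs c) b := by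
  refine complementExtends_kreweras hb (fun w hw => movP_sup_movP_eq_top hp hm hlen hw)
    (fun w hw L hL => movP_le_span hp hm hlen hw hL) ?_
  rintro s t hst _ ⟨u, hu, rfl⟩ _ ⟨v, hv, rfl⟩
  exact h s t hst u v hu hv

end Prime

section EulerMatrix

open scoped Matrix

theorem toBilin'_intCast {B : Type*} [Fintype B] [DecidableEq B] (K : Type*) [CommRing K]
    (N : Matrix B B ℤ) (u v : B → ℤ) :
    Matrix.toBilin' (N.map (Int.cast : ℤ → K)) (fun i => (u i : K)) (fun i => (v i : K)) =
      (Matrix.toBilin' N u v : ℤ) := by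
  simp [Matrix.toBilin'_apply]

variable {B W : Type*} [Fintype B] [DecidableEq B] [Group W] {M : CoxeterMatrix B}
  {A : Matrix B B ℤ} {d : B → ℤ} {cs : CoxeterSystem M W}
  {hA : IsCartan M (A.map (Int.cast : ℤ → ℝ))} {c : W} {N : Matrix B B ℤ}

omit [Fintype B] [DecidableEq B] in
theorem intCast_mul_comm (hd : ∀ i j, A i j * d j = A j i * d i) (i j : B) :
    A.map (Int.cast : ℤ → ℝ) i j * (d j : ℝ) = A.map (Int.cast : ℤ → ℝ) j i * (d i : ℝ) := by
  simpa using congrArg (Int.cast : ℤ → ℝ) (hd i j)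

/-- `N` is an integral matrix of the Euler form of `c` with respect to the invariant form. It
defines a form over every field, in particular over `ZMod p`. -/
def IsEulerMatrix (cs : CoxeterSystem M W) (hA : IsCartan M (A.map (Int.cast : ℤ → ℝ)))
    (d : B → ℤ) (c : W) (N : Matrix B B ℤ) : Prop :=
  IsEulerForm (Matrix.toBilin' (N.map (Int.cast : ℤ → ℝ)))
    (cartanForm (A.map (Int.cast : ℤ → ℝ)) fun i => (d i : ℝ)) (geomRep cs hA c)

namespace IsEulerMatrix

variable (hN : IsEulerMatrix cs hA d c N) (hd : ∀ i j, A i j * d j = A j i * d i)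
  (hm : mov cs hA c = ⊤) (hlen : absLength cs c = Fintype.card B) (K : Type*) [Field K]
include hN hd hm

theorem root_self_ne_zero (hK : ∀ i, (d i : K) ≠ 0) {t : W} {v : B → ℤ}
    (hv : IsIntRootOf cs hA t v) :
    Matrix.toBilin' (N.map (Int.cast : ℤ → K)) (fun i => (v i : K)) (fun i => (v i : K)) ≠ 0 := by
  obtain ⟨i, hi⟩ := hN.exists_root_self (intCast_mul_comm hd) hm hv
  rw [toBilin'_intCast, Int.cast_inj] at hi
  rw [toBilin'_intCast, hi]
  exact hK i

include hlen

theorem root_eq_zero {s t : W} (hst : Subordinates cs c s t) {u v : B → ℤ}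
    (hu : IsIntRootOf cs hA s u) (hv : IsIntRootOf cs hA t v) :
    Matrix.toBilin' (N.map (Int.cast : ℤ → K)) (fun i => (u i : K)) (fun i => (v i : K)) = 0 := by
  have h := IsEulerForm.root_eq_zero hN (cartanForm_geomRep cs hA (intCast_mul_comm hd)) hm hlen
    hst hu hv
  rw [toBilin'_intCast, Int.cast_eq_zero] at h
  rw [toBilin'_intCast, h, Int.cast_zero]

theorem triangular {L : List W} (hL : IsReducedFactorization cs L c) {v : Fin L.length → B → ℤ}
    (hv : ∀ i, IsIntRootOf cs hA (L.get i) (v i)) (i j : Fin L.length) (hij : i < j) :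
    Matrix.toBilin' (N.map (Int.cast : ℤ → K)) (fun k => (v i k : K)) (fun k => (v j k : K)) = 0 :=
  hN.root_eq_zero hd hm hlen K (List.pairwise_iff_get.1 hL.pairwise_subordinates i j hij)
    (hv i) (hv j)

variable (hK : ∀ i, (d i : K) ≠ 0)
include hK

theorem compatibleAt : CompatibleAt cs hA c K := fun _ hL _ hv =>
  linearIndependent_of_triangular (hN.triangular hd hm hlen K hL hv)
    fun i => hN.root_self_ne_zero hd hm K hK (hv i)

theorem nondegenerate : (Matrix.toBilin' (N.map (Int.cast : ℤ → K))).Nondegenerate := by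
  obtain ⟨L, hL⟩ := exists_isReducedFactorization cs c
  choose v hv using fun i => exists_isIntRootOf cs hA (hL.isReflection _ (L.get_mem i))
  exact nondegenerate_of_triangular
    (by rw [hL.length_eq, hlen, Module.finrank_fintype_fun_eq_card])
    (hN.triangular hd hm hlen K hL hv) fun i => hN.root_self_ne_zero hd hm K hK (hv i)

omit K [Field K] hK in
theorem complementExtends (p : ℕ) [Fact p.Prime] (hp : ∀ i, (d i : ZMod p) ≠ 0) :
    ComplementExtends (fun w : NC cs c => movP cs hA p w.1) (kreweras cs c)
      (Matrix.toBilin' (N.map (Int.cast : ℤ → ZMod p))) :=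
  complementExtends_movP (hN.compatibleAt hd hm hlen _ hp) hm hlen
    (hN.nondegenerate hd hm hlen _ hp)
    fun _ _ hst _ _ hu hv => hN.root_eq_zero hd hm hlen _ hst hu hv

omit hm hlen K [Field K] hK in
theorem exists_conj (w : W) : ∃ N', IsEulerMatrix cs hA d (w * c * w⁻¹) N' := by
  obtain ⟨ρ, hρ⟩ := exists_intMatrix_geomRep cs hA
  refine ⟨(ρ w⁻¹)ᵀ * N * ρ w⁻¹, ?_⟩
  have hsymm : ((geomRep cs hA w).symm : (B → ℝ) →ₗ[ℝ] (B → ℝ)) =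
      Matrix.toLin' ((ρ w⁻¹).map (Int.cast : ℤ → ℝ)) := by
    rw [← hρ, map_inv]
    rfl
  have hmap : ((ρ w⁻¹)ᵀ * N * ρ w⁻¹).map (Int.cast : ℤ → ℝ) =
      ((ρ w⁻¹).map (Int.cast : ℤ → ℝ))ᵀ * N.map (Int.cast : ℤ → ℝ) *
        (ρ w⁻¹).map (Int.cast : ℤ → ℝ) := by
    rw [Matrix.map_mul_intCast, Matrix.map_mul_intCast, Matrix.transpose_map]
  have hconj := IsEulerForm.conj hN (cartanForm_geomRep cs hA (intCast_mul_comm hd) w)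
  rwa [hsymm, Matrix.toBilin'_comp, ← hmap, ← map_inv, ← map_mul, ← map_mul] at hconj

end IsEulerMatrix

theorem isEulerMatrix_wordProd (cs : CoxeterSystem M W)
    (hA : IsCartan M (A.map (Int.cast : ℤ → ℝ))) {l : List B} (hl : ∀ i, i ∈ l)
    (hdiag : ∀ i, N i i = d i) (htri : l.Pairwise fun i j => N i j = 0 ∧ N j i = A j i * d i) :
    IsEulerMatrix cs hA d (cs.wordProd l) N := by
  have hN i j : Matrix.toBilin' (N.map (Int.cast : ℤ → ℝ)) (simpleRoot i) (simpleRoot j) =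
      N i j := by simp [simpleRoot]
  intro x y
  refine LinearMap.congr_fun ((Pi.basisFun ℝ B).ext fun k => ?_) y
  rw [Pi.basisFun_apply, ← simpleRoot, cartanForm_simpleRoot, geomRep_wordProd]
  refine bilin_sub_reflection_prod (d := fun i => (d i : ℝ)) (coroot_self hA) (fun i _ => ?_)
    (htri.imp fun {i j} h => ?_) x k (hl k)
  · rw [hN, hdiag]
  · rw [hN, hN, h.1, h.2, coroot_simpleRoot]
    simp

theorem exists_isEulerMatrix (hA : IsCartan M (A.map (Int.cast : ℤ → ℝ)))
    (hd : ∀ i j, A i j * d j = A j i * d i) (hc : IsCoxeterElement cs c) :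
    ∃ N, IsEulerMatrix cs hA d c N := by
  obtain ⟨l, hnodup, hl, w, rfl⟩ := hc
  let E : Matrix B B ℤ := Matrix.of fun i j =>
    if i = j then d i else if l.idxOf j < l.idxOf i then A i j * d j else 0
  have hE : IsEulerMatrix cs hA d (cs.wordProd l) E := by
    refine isEulerMatrix_wordProd cs hA hl (fun i => by simp [E]) ?_
    rw [List.pairwise_iff_getElem]
    intro i j hi hj hij
    have hne : l[i] ≠ l[j] := fun h => hij.ne ((hnodup.getElem_inj_iff).1 h)
    simp [E, hne, hne.symm, hnodup.idxOf_getElem, hij, hij.le]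
  exact hE.exists_conj hd w

end EulerMatrix

section Dihedral

variable {B W : Type*} [Fintype B] [DecidableEq B] [Group W] {M : CoxeterMatrix B}
  {cs : CoxeterSystem M W} {c l r : W} (hb : IsBipartition c l r)

theorem mov_phiLeft {A : Matrix B B ℝ} (hA : IsCartan M A) (w : NC cs c) :
    mov cs hA (phiLeft cs hb w).1 =
      (mov cs hA w.1).map (geomRep cs hA l : (B → ℝ) →ₗ[ℝ] (B → ℝ)) := by
  rw [phiLeft_val, mov_conj, mov_inv]

theorem movP_phiLeft {A : Matrix B B ℝ} (hA : IsCartan M A) (p : ℕ) (w : NC cs c) :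
    movP cs hA p (phiLeft cs hb w).1 = movP cs hA p (l * w.1 * l⁻¹) := by
  rw [movP, movP, mov_phiLeft, mov_conj]

theorem skewExtends_mov_of_mem_dihedral {A : Matrix B B ℝ} (hA : IsCartan M A) (hdet : A.det ≠ 0)
    {d : B → ℝ} (hd : ∀ i j, A i j * d j = A j i * d i) (hd0 : ∀ i, d i ≠ 0)
    (hc : IsCoxeterElement cs c) {g : Equiv.Perm (NC cs c)} (hg : g ∈ dihedral cs hb) :
    SkewExtends (fun w : NC cs c => mov cs hA w.1) g := by
  have hm := mov_coxeterElement cs hA hdet hc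
  have hlen := absLength_coxeterElement cs hA hdet hc
  have hmoved : movedSpace (geomRep cs hA c) = ⊤ := (mov_eq_movedSpace cs hA c).symm.trans hm
  obtain ⟨b, hEuler⟩ := exists_isEulerForm (cartanForm A d) hmoved
  have hnd : b.Nondegenerate :=
    hEuler.nondegenerate (cartanForm_nondegenerate hdet hd0) hmoved
  have hext : ComplementExtends (fun w : NC cs c => mov cs hA w.1) (kreweras cs c) b :=
    complementExtends_mov hm hnd fun _ _ hst _ _ hu hv =>
      hEuler.root_eq_zero (cartanForm_geomRep cs hA hd) hm hlen hst hu hv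
  exact skewExtends_of_mem_dihedral hb (fun w => (mov_phiLeft hb hA w).symm) hnd hext hg

theorem skewExtends_movP_of_mem_dihedral {A : Matrix B B ℤ}
    (hA : IsCartan M (A.map (Int.cast : ℤ → ℝ))) (hdet : (A.map (Int.cast : ℤ → ℝ)).det ≠ 0)
    {d : B → ℤ} (hd : ∀ i j, A i j * d j = A j i * d i) (p : ℕ) [Fact p.Prime]
    (hp : ∀ i, (d i : ZMod p) ≠ 0) (hc : IsCoxeterElement cs c) {g : Equiv.Perm (NC cs c)}
    (hg : g ∈ dihedral cs hb) : SkewExtends (fun w : NC cs c => movP cs hA p w.1) g := by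
  have hm := mov_coxeterElement cs hA hdet hc
  have hlen := absLength_coxeterElement cs hA hdet hc
  obtain ⟨N, hN⟩ := exists_isEulerMatrix hA hd hc
  obtain ⟨e, he⟩ := exists_map_movP_eq_conj cs hA p l
  exact skewExtends_of_mem_dihedral hb (fun w => (he w.1).trans (movP_phiLeft hb hA p w).symm)
    (hN.nondegenerate hd hm hlen _ hp) (hN.complementExtends hd hm hlen p hp) hg

end Dihedral

/-! ## Diagonal conjugation of matrices supported on a forest -/

section Forest

variable {K : Type*} [Field K]

theorem exists_scaling_of_subsingleton_support {ι : Type*} {r r' s s' x : ι → K}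
    (hprod : ∀ i, r i * s i = r' i * s' i) (hr : ∀ i, r i = 0 ↔ r' i = 0)
    (hs : ∀ i, s i = 0 ↔ s' i = 0) (hrs : ∀ i, r i = 0 → s i = 0)
    (hsub : ∀ i j, r i ≠ 0 → r j ≠ 0 → i = j) (hx : ∀ i, x i ≠ 0) :
    ∃ y ≠ 0, ∀ i, r i * x i = y * r' i ∧ s i * y = x i * s' i := by
  have hzero i (h : r i = 0) (y : K) : r i * x i = y * r' i ∧ s i * y = x i * s' i := by
    rw [h, (hr i).1 h, hrs i h, (hs i).1 (hrs i h)]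
    simp
  by_cases hex : ∃ i, r i ≠ 0
  · obtain ⟨i, hi⟩ := hex
    have hi' : r' i ≠ 0 := mt (hr i).2 hi
    refine ⟨r i * x i / r' i, div_ne_zero (mul_ne_zero hi (hx i)) hi', fun j => ?_⟩
    by_cases hj : r j = 0
    · exact hzero j hj _
    · obtain rfl := hsub j i hj hi
      refine ⟨(div_mul_cancel₀ _ hi').symm, ?_⟩
      field_simp
      linear_combination x j * hprod j
  · push Not at hex
    exact ⟨1, one_ne_zero, fun i => hzero i (hex i) 1⟩

/-- If every node has at most one smaller neighbour, then the support is a forest, and the scaling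
factors are chosen from the roots to the leaves. -/
theorem exists_diagonal_conj_of_forest {n : ℕ} {A A' : Matrix (Fin n) (Fin n) K}
    (hdiag : ∀ i, A i i = A' i i) (hprod : ∀ i j, A i j * A j i = A' i j * A' j i)
    (hzero : ∀ i j, A i j = 0 ↔ A' i j = 0) (hsymm : ∀ i j, A i j = 0 → A j i = 0)
    (hparent : ∀ i j j', j < i → j' < i → A i j ≠ 0 → A i j' ≠ 0 → j = j') :
    ∃ x : Fin n → K, (∀ i, x i ≠ 0) ∧ ∀ i j, A i j * x j = x i * A' i j := by
  induction n with
  | zero => exact ⟨1, fun _ => one_ne_zero, fun i => i.elim0⟩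
  | succ n ih =>
    obtain ⟨x, hx, hxA⟩ := ih (A := A.submatrix Fin.castSucc Fin.castSucc)
      (A' := A'.submatrix Fin.castSucc Fin.castSucc) (fun _ => hdiag _) (fun _ _ => hprod _ _)
      (fun _ _ => hzero _ _) (fun _ _ => hsymm _ _)
      fun _ _ _ hj hj' h h' => Fin.castSucc_injective n (hparent _ _ _ hj hj' h h')
    obtain ⟨y, hy, hxy⟩ := exists_scaling_of_subsingleton_support (x := x)
      (fun i => hprod (Fin.last n) i.castSucc) (fun _ => hzero _ _) (fun _ => hzero _ _)
      (fun _ => hsymm _ _) (fun i j h h' => Fin.castSucc_injective n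
        (hparent _ _ _ i.castSucc_lt_last j.castSucc_lt_last h h')) hx
    refine ⟨Fin.snoc x y, Fin.lastCases (by simpa) fun i => by simpa using hx i,
      Fin.lastCases (Fin.lastCases ?_ fun j => ?_) fun i => Fin.lastCases ?_ fun j => ?_⟩
    · rw [hdiag, mul_comm]
    · simpa using (hxy j).1
    · simpa using (hxy i).2
    · simpa using hxA i j

theorem det_eq_of_diagonal_conj {ι : Type*} [Fintype ι] [DecidableEq ι] {A A' : Matrix ι ι K}
    {x : ι → K} (hx : ∀ i, x i ≠ 0) (h : ∀ i j, A i j * x j = x i * A' i j) : A.det = A'.det := by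
  have hmul : A * Matrix.diagonal x = Matrix.diagonal x * A' :=
    Matrix.ext fun i j => by simpa using h i j
  have hdet := congrArg Matrix.det hmul
  rw [Matrix.det_mul, Matrix.det_mul, Matrix.det_diagonal, mul_comm] at hdet
  exact mul_left_cancel₀ (Finset.prod_ne_zero_iff.2 fun i _ => hx i) hdet

end Forest

theorem IsCartan.exists_diagonal_conj {n : ℕ} {M : CoxeterMatrix (Fin n)}
    {A A' : Matrix (Fin n) (Fin n) ℝ} (hA : IsCartan M A) (hA' : IsCartan M A')
    (hM : ∀ i j, M i j ≠ 0)
    (hparent : ∀ i j j', j < i → j' < i → A' i j ≠ 0 → A' i j' ≠ 0 → j = j') :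
    ∃ x : Fin n → ℝ, (∀ i, x i ≠ 0) ∧ ∀ i j, A i j * x j = x i * A' i j := by
  have hprod i j : A i j * A j i = A' i j * A' j i := by
    obtain rfl | hij := eq_or_ne i j
    · rw [hA.diag, hA'.diag]
    · rw [hA.prod i j hij (hM i j), hA'.prod i j hij (hM i j)]
  have hzero i j : A i j = 0 ↔ A' i j = 0 := by
    have hA0 : A i j = 0 ↔ A i j * A j i = 0 :=
      ⟨fun h => by rw [h, zero_mul], fun h => (mul_eq_zero.1 h).elim id (hA.zero j i)⟩
    have hA'0 : A' i j = 0 ↔ A' i j * A' j i = 0 :=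
      ⟨fun h => by rw [h, zero_mul], fun h => (mul_eq_zero.1 h).elim id (hA'.zero j i)⟩
    rw [hA0, hA'0, hprod]
  exact exists_diagonal_conj_of_forest (fun i => by rw [hA.diag, hA'.diag]) hprod hzero hA.zero
    fun i j j' hj hj' h h' =>
      hparent i j j' hj hj' (mt (hzero i j).2 h) (mt (hzero i j').2 h')

/-! ## The classical types -/

namespace ClassicalType

/-- Half of the squared lengths of the simple roots for the invariant form that is the
symmetrization of `b_X`. -/
def halfNorm (X : ClassicalType) (n : ℕ) (i : Fin n) : ℤ :=
  match X with
  | A => 1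
  | B => if i.val + 1 = n then 1 else 2
  | D => 2

/-- The values of the Euler form of `s_1 ⋯ s_n` on pairs of simple roots: the lower triangular
matrix whose symmetrization is the matrix of the invariant form. -/
def eulerMatrix (X : ClassicalType) (n : ℕ) : Matrix (Fin n) (Fin n) ℤ :=
  Matrix.of fun i j =>
    if i = j then X.halfNorm n i else if j < i then X.cartan n i j * X.halfNorm n j else 0

/-- The matrix whose rows are the simple roots in the basis `e`. -/
def rootMatrix (X : ClassicalType) (n : ℕ) (K : Type*) [Ring K] : Matrix (Fin n) (Fin n) K :=
  Matrix.of (X.simpleVec n K)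

section Cartan

variable (X : ClassicalType) (n : ℕ)

theorem cartan_diag (i : Fin n) : X.cartan n i i = 2 := by
  cases X <;> simp [cartan, CartanMatrix.A]

theorem cartan_mul_halfNorm (i j : Fin n) :
    X.cartan n i j * X.halfNorm n j = X.cartan n j i * X.halfNorm n i := by
  cases X <;>
    simp only [cartan, halfNorm, CartanMatrix.A, CartanMatrix.B, CartanMatrix.D, Matrix.of_apply,
      Fin.ext_iff] <;>
    split_ifs <;> omega

theorem cartan_parent (i j j' : Fin n) (hj : j < i) (hj' : j' < i) (h : X.cartan n i j ≠ 0)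
    (h' : X.cartan n i j' ≠ 0) : j = j' := by
  cases X <;>
    simp only [cartan, CartanMatrix.A, CartanMatrix.B, CartanMatrix.D, Matrix.of_apply,
      Fin.ext_iff, Fin.lt_def] at * <;>
    split_ifs at h h' <;> omega

theorem coxeterMatrix_ne_zero (i j : Fin n) : X.coxeterMatrix n i j ≠ 0 := by
  cases X <;>
    simp only [coxeterMatrix, CoxeterMatrix.A, CoxeterMatrix.B, coxeterMatrixD, Matrix.of_apply] <;>
    split_ifs <;> norm_num

variable {X} in
theorem halfNorm_cast_ne_zero {K : Type*} [Field K] (h : X = A ∨ (2 : K) ≠ 0) (i : Fin n) :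
    (X.halfNorm n i : K) ≠ 0 := by
  cases X with
  | A => simp [halfNorm]
  | B =>
    have h2 : (2 : K) ≠ 0 := h.resolve_left (by simp)
    simp only [halfNorm]
    split_ifs <;> simp [h2]
  | D => simpa [halfNorm] using h

theorem eulerMatrix_diag (i : Fin n) : X.eulerMatrix n i i = X.halfNorm n i := by
  simp [eulerMatrix]

theorem eulerMatrix_of_lt {i j : Fin n} (h : i < j) : X.eulerMatrix n i j = 0 := by
  simp [eulerMatrix, h.ne, h.not_gt]

theorem eulerMatrix_of_gt {i j : Fin n} (h : j < i) :
    X.eulerMatrix n i j = X.cartan n i j * X.halfNorm n j := by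
  simp [eulerMatrix, h.ne', h]

theorem eulerMatrix_add_swap (i j : Fin n) :
    X.eulerMatrix n i j + X.eulerMatrix n j i = X.cartan n i j * X.halfNorm n j := by
  rcases lt_trichotomy i j with h | rfl | h
  · rw [eulerMatrix_of_lt X n h, eulerMatrix_of_gt X n h, zero_add, cartan_mul_halfNorm]
  · rw [eulerMatrix_diag, cartan_diag, two_mul]
  · rw [eulerMatrix_of_lt X n h, eulerMatrix_of_gt X n h, add_zero]

theorem isEulerMatrix {W : Type*} [Group W] (cs : CoxeterSystem (X.coxeterMatrix n) W) :
    IsEulerMatrix cs (X.isCartan n) (X.halfNorm n) (cs.wordProd (List.finRange n))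
      (X.eulerMatrix n) :=
  isEulerMatrix_wordProd cs _ List.mem_finRange (eulerMatrix_diag X n) <|
    (List.pairwise_lt_finRange n).imp fun h => ⟨eulerMatrix_of_lt X n h, eulerMatrix_of_gt X n h⟩

theorem det_eulerMatrix : (X.eulerMatrix n).det = ∏ i, X.halfNorm n i := by
  rw [Matrix.det_of_isLowerTriangular _ fun _ _ h => eulerMatrix_of_lt X n h]
  exact Finset.prod_congr rfl fun i _ => eulerMatrix_diag X n i

variable {X} in
theorem det_eulerMatrix_map_ne_zero {K : Type*} [Field K] (h : X = A ∨ (2 : K) ≠ 0) :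
    ((X.eulerMatrix n).map (Int.cast : ℤ → K)).det ≠ 0 := by
  have hcast : ((X.eulerMatrix n).map (Int.cast : ℤ → K)).det = ((X.eulerMatrix n).det : ℤ) :=
    (Int.cast_det _).symm
  rw [hcast, det_eulerMatrix, Int.cast_prod]
  exact Finset.prod_ne_zero_iff.2 fun i _ => halfNorm_cast_ne_zero n h i

end Cartan

section Form

open scoped Matrix

variable (X : ClassicalType) {n : ℕ} (K : Type*)

section Ring

variable [Ring K]

theorem simpleVec_of_lt {i : Fin n} (h : i.val + 1 < n) :
    X.simpleVec n K i = Pi.single i 1 - Pi.single ⟨i.val + 1, h⟩ 1 := by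
  ext k
  cases X <;> simp only [simpleVec, if_neg h.ne, Pi.sub_apply, Pi.single_apply, Fin.ext_iff] <;>
    split_ifs <;> first | omega | simp

variable {X} in
theorem simpleVec_last (hX : X ≠ D) {i : Fin n} (h : i.val + 1 = n) :
    X.simpleVec n K i = Pi.single i 1 := by
  ext k
  have hk := k.2
  cases X
  case D => exact absurd rfl hX
  all_goals
    simp only [simpleVec, Pi.single_apply, Fin.ext_iff]
    split_ifs <;> first | omega | simp

theorem simpleVec_D_last {i : Fin n} (h : i.val + 1 = n) (hn : 2 ≤ n) :
    D.simpleVec n K i = Pi.single i 1 + Pi.single ⟨i.val - 1, by omega⟩ 1 := by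
  ext k
  have hk := k.2
  simp only [simpleVec, if_pos h, Pi.add_apply, Pi.single_apply, Fin.ext_iff]
  split_ifs <;> first | omega | simp

variable (N : Matrix (Fin n) (Fin n) K)

theorem rootMatrix_mul_apply (i : Fin n) : (X.rootMatrix n K * N) i = X.simpleVec n K i ᵥ* N := by
  rw [Matrix.mul_apply_eq_vecMul]
  rfl

theorem rootMatrix_mul_of_lt {i : Fin n} (h : i.val + 1 < n) (j : Fin n) :
    (X.rootMatrix n K * N) i j = N i j - N ⟨i.val + 1, h⟩ j := by
  rw [rootMatrix_mul_apply, simpleVec_of_lt X K h, Matrix.sub_vecMul]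
  simp

variable {X} in
theorem rootMatrix_mul_last (hX : X ≠ D) {i : Fin n} (h : i.val + 1 = n) (j : Fin n) :
    (X.rootMatrix n K * N) i j = N i j := by
  rw [rootMatrix_mul_apply, simpleVec_last K hX h]
  simp

theorem rootMatrix_D_mul_last {i : Fin n} (h : i.val + 1 = n) (hn : 2 ≤ n) (j : Fin n) :
    (D.rootMatrix n K * N) i j = N i j + N ⟨i.val - 1, by omega⟩ j := by
  rw [rootMatrix_mul_apply, simpleVec_D_last K h hn, Matrix.add_vecMul]
  simp

theorem rootMatrix_A_mul_gram : A.rootMatrix n K * A.gram n K = 1 := by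
  ext i j
  have hj := j.2
  obtain h | h : i.val + 1 < n ∨ i.val + 1 = n := by omega
  · rw [rootMatrix_mul_of_lt A K _ h]
    simp only [gram, Matrix.one_apply, Matrix.of_apply, Fin.ext_iff, Fin.le_def]
    split_ifs <;> first | omega | norm_num
  · rw [rootMatrix_mul_last (X := A) K _ nofun h]
    simp only [gram, Matrix.one_apply, Matrix.of_apply, Fin.ext_iff, Fin.le_def]
    split_ifs <;> first | omega | norm_num

theorem rootMatrix_B_mul_gram (i j : Fin n) : (B.rootMatrix n K * B.gram n K) i j =
    if i.val + 1 = n then (if j = i then 1 else -1) else if j = i then 2 else 0 := by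
  have hj := j.2
  obtain h | h : i.val + 1 < n ∨ i.val + 1 = n := by omega
  · rw [rootMatrix_mul_of_lt B K _ h]
    simp only [gram, Matrix.of_apply, Fin.ext_iff, Fin.le_def]
    split_ifs <;> first | omega | norm_num
  · rw [rootMatrix_mul_last (X := B) K _ nofun h]
    simp only [gram, Matrix.of_apply, Fin.ext_iff, Fin.le_def]
    split_ifs <;> first | omega | norm_num

theorem rootMatrix_D_mul_gram (hn : 2 ≤ n) (i j : Fin n) :
    (D.rootMatrix n K * D.gram n K) i j =
      if i.val + 2 < n then (if j = i then 2 else 0)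
      else if j.val + 2 < n then -1
      else if j.val + 2 = n then 1 else if i.val + 1 = n then 1 else -1 := by
  have hj := j.2
  obtain h | h : i.val + 1 < n ∨ i.val + 1 = n := by omega
  · rw [rootMatrix_mul_of_lt D K _ h]
    simp only [gram, Matrix.of_apply, Fin.ext_iff, Fin.le_def, Fin.lt_def]
    split_ifs <;> first | omega | norm_num
  · rw [rootMatrix_D_mul_last K _ h hn]
    simp only [gram, Matrix.of_apply, Fin.ext_iff, Fin.le_def, Fin.lt_def]
    split_ifs <;> first | omega | norm_num

end Ring

theorem eulerMatrix_A (i j : Fin n) :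
    A.eulerMatrix n i j = if i = j then 1 else if j.val + 1 = i.val then -1 else 0 := by
  simp only [eulerMatrix, cartan, halfNorm, CartanMatrix.A, Matrix.of_apply, Fin.ext_iff,
    Fin.lt_def]
  split_ifs <;> omega

theorem eulerMatrix_B (i j : Fin n) :
    B.eulerMatrix n i j = if i = j then (if i.val + 1 = n then 1 else 2)
      else if j.val + 1 = i.val then -2 else 0 := by
  simp only [eulerMatrix, cartan, halfNorm, CartanMatrix.B, Matrix.of_apply, Fin.ext_iff,
    Fin.lt_def]
  split_ifs <;> omega

theorem eulerMatrix_D (hn : 3 ≤ n) (i j : Fin n) :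
    D.eulerMatrix n i j = if i = j then 2
      else if (j.val + 1 = i.val ∧ i.val + 1 < n) ∨ (j.val + 3 = n ∧ i.val + 1 = n) then -2
      else 0 := by
  simp only [eulerMatrix, cartan, halfNorm, CartanMatrix.D, Matrix.of_apply, Fin.ext_iff,
    Fin.lt_def]
  split_ifs <;> omega

variable [CommRing K]

theorem rootMatrix_mul_gram_mul_transpose_apply (i j : Fin n) :
    (X.rootMatrix n K * X.gram n K * (X.rootMatrix n K)ᵀ) i j =
      (X.rootMatrix n K * (X.rootMatrix n K * X.gram n K)ᵀ) j i := by
  rw [← Matrix.transpose_apply (_ * (_ * _)ᵀ), Matrix.transpose_mul, Matrix.transpose_transpose]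

theorem rootMatrix_B_mul_gram_mul_transpose :
    B.rootMatrix n K * B.gram n K * (B.rootMatrix n K)ᵀ = (B.eulerMatrix n).map Int.cast := by
  ext i j
  have hi := i.2
  rw [rootMatrix_mul_gram_mul_transpose_apply, Matrix.map_apply, eulerMatrix_B]
  obtain h | h : j.val + 1 < n ∨ j.val + 1 = n := by omega
  · rw [rootMatrix_mul_of_lt B K _ h]
    simp only [rootMatrix_B_mul_gram, Matrix.transpose_apply, Fin.ext_iff]
    split_ifs <;> first | omega | norm_num
  · rw [rootMatrix_mul_last (X := B) K _ nofun h]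
    simp only [rootMatrix_B_mul_gram, Matrix.transpose_apply, Fin.ext_iff]
    split_ifs <;> first | omega | norm_num

theorem rootMatrix_D_mul_gram_mul_transpose (hn : 3 ≤ n) :
    D.rootMatrix n K * D.gram n K * (D.rootMatrix n K)ᵀ = (D.eulerMatrix n).map Int.cast := by
  ext i j
  have hi := i.2
  have hn2 : 2 ≤ n := Nat.le_of_succ_le hn
  rw [rootMatrix_mul_gram_mul_transpose_apply, Matrix.map_apply, eulerMatrix_D hn]
  obtain h | h : j.val + 1 < n ∨ j.val + 1 = n := by omega
  · rw [rootMatrix_mul_of_lt D K _ h]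
    simp only [rootMatrix_D_mul_gram K hn2, Matrix.transpose_apply, Fin.ext_iff]
    split_ifs <;> first | omega | norm_num
  · rw [rootMatrix_D_mul_last K _ h hn2]
    simp only [rootMatrix_D_mul_gram K hn2, Matrix.transpose_apply, Fin.ext_iff]
    split_ifs <;> first | omega | norm_num

theorem rootMatrix_mul_gram_mul_transpose (hn : X.minRank ≤ n) :
    X.rootMatrix n K * X.gram n K * (X.rootMatrix n K)ᵀ = (X.eulerMatrix n).map Int.cast := by
  cases X with
  | A =>
    rw [rootMatrix_A_mul_gram, one_mul]
    ext i j
    simp only [rootMatrix, simpleVec, eulerMatrix_A, Matrix.transpose_apply, Matrix.of_apply,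
      Matrix.map_apply, Fin.ext_iff]
    split_ifs <;> first | omega | norm_num
  | B => exact rootMatrix_B_mul_gram_mul_transpose K
  | D => exact rootMatrix_D_mul_gram_mul_transpose K hn

end Form

section Field

variable (X : ClassicalType) {n : ℕ}

theorem form_eq_toBilin' (hn : X.minRank ≤ n) (K : Type*) [Field K] :
    X.form n K = Matrix.toBilin' ((X.eulerMatrix n).map (Int.cast : ℤ → K)) := by
  have hcomb : Fintype.linearCombination K (X.simpleVec n K) =
      Matrix.toLin' (X.rootMatrix n K).transpose := by
    ext i j
    simp [rootMatrix]
  rw [form, hcomb, Matrix.toBilin'_comp, Matrix.transpose_transpose,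
    rootMatrix_mul_gram_mul_transpose X K hn]

variable {X} in
theorem form_nondegenerate (hn : X.minRank ≤ n) {K : Type*} [Field K] (h : X = A ∨ (2 : K) ≠ 0) :
    (X.form n K).Nondegenerate := by
  rw [form_eq_toBilin' X hn, LinearMap.BilinForm.nondegenerate_toBilin'_iff_det_ne_zero]
  exact det_eulerMatrix_map_ne_zero n h

theorem det_gram_add_transpose_ne_zero : (X.gram n ℝ + (X.gram n ℝ).transpose).det ≠ 0 := by
  have htwo (h : X.gram n ℝ + (X.gram n ℝ).transpose = (2 : ℝ) • 1) :
      (X.gram n ℝ + (X.gram n ℝ).transpose).det ≠ 0 := by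
    rw [h, Matrix.det_smul, Matrix.det_one]
    positivity
  cases X with
  | A =>
    have hones : A.gram n ℝ + (A.gram n ℝ).transpose =
        1 + Matrix.replicateCol Unit (1 : Fin n → ℝ) *
          Matrix.replicateRow Unit (1 : Fin n → ℝ) := by
      ext i j
      simp only [gram, Matrix.add_apply, Matrix.transpose_apply, Matrix.of_apply, Matrix.mul_apply,
        Matrix.replicateCol_apply, Matrix.replicateRow_apply, Pi.one_apply, Finset.univ_unique,
        Finset.sum_singleton, Matrix.one_apply, Fin.ext_iff, Fin.le_def]
      split_ifs <;> first | omega | norm_num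
    rw [hones, Matrix.det_one_add_replicateCol_mul_replicateRow, one_dotProduct_one,
      Fintype.card_fin]
    positivity
  | B =>
    refine htwo (Matrix.ext fun i j => ?_)
    simp only [gram, Matrix.add_apply, Matrix.transpose_apply, Matrix.of_apply, Matrix.smul_apply,
      Matrix.one_apply, smul_eq_mul, Fin.ext_iff, Fin.le_def]
    split_ifs <;> first | omega | norm_num
  | D =>
    refine htwo (Matrix.ext fun i j => ?_)
    have hi := i.2
    have hj := j.2
    simp only [gram, Matrix.add_apply, Matrix.transpose_apply, Matrix.of_apply, Matrix.smul_apply,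
      Matrix.one_apply, smul_eq_mul, Fin.ext_iff, Fin.le_def, Fin.lt_def]
    split_ifs <;> first | omega | norm_num

theorem det_cartan_ne_zero (hn : X.minRank ≤ n) :
    ((X.cartan n).map (Int.cast : ℤ → ℝ)).det ≠ 0 := by
  set P := X.rootMatrix n ℝ
  set G := X.gram n ℝ
  set E := (X.eulerMatrix n).map (Int.cast : ℤ → ℝ)
  have hE : P * G * P.transpose = E := rootMatrix_mul_gram_mul_transpose X ℝ hn
  have hP : P.det ≠ 0 := by
    have hEdet : E.det ≠ 0 := det_eulerMatrix_map_ne_zero n (Or.inr two_ne_zero)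
    rw [← hE, Matrix.det_mul, Matrix.det_mul] at hEdet
    exact left_ne_zero_of_mul (left_ne_zero_of_mul hEdet)
  have hcartan : (X.cartan n).map (Int.cast : ℤ → ℝ) *
      Matrix.diagonal (fun i => (X.halfNorm n i : ℝ)) = P * (G + G.transpose) * P.transpose := by
    have htranspose : P * G.transpose * P.transpose = E.transpose := by
      rw [← hE]
      simp only [Matrix.transpose_mul, Matrix.transpose_transpose, Matrix.mul_assoc]
    rw [Matrix.mul_add, Matrix.add_mul, hE, htranspose]
    ext i j
    simpa [E] using (congrArg (Int.cast : ℤ → ℝ) (X.eulerMatrix_add_swap n i j)).symm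
  have hdet := congrArg Matrix.det hcartan
  rw [Matrix.det_mul, Matrix.det_mul, Matrix.det_mul, Matrix.det_transpose] at hdet
  exact left_ne_zero_of_mul
    (hdet ▸ mul_ne_zero (mul_ne_zero hP X.det_gram_add_transpose_ne_zero) hP)

variable {A : Matrix (Fin n) (Fin n) ℝ} (hA : IsCartan (X.coxeterMatrix n) A)

include hA in
theorem exists_diagonal_conj :
    ∃ x : Fin n → ℝ, (∀ i, x i ≠ 0) ∧ ∀ i j, A i j * x j = x i * X.cartan n i j :=
  hA.exists_diagonal_conj (X.isCartan n) (X.coxeterMatrix_ne_zero n) fun i j j' hj hj' h h' =>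
    X.cartan_parent n i j j' hj hj' (by simpa using h) (by simpa using h')

include hA in
theorem det_ne_zero (hn : X.minRank ≤ n) : A.det ≠ 0 := by
  obtain ⟨x, hx, h⟩ := X.exists_diagonal_conj hA
  rw [det_eq_of_diagonal_conj (A' := (X.cartan n).map Int.cast) hx h]
  exact X.det_cartan_ne_zero hn

include hA in
theorem exists_symmetrizer :
    ∃ d : Fin n → ℝ, (∀ i, d i ≠ 0) ∧ ∀ i j, A i j * d j = A j i * d i := by
  obtain ⟨x, hx, h⟩ := X.exists_diagonal_conj hA
  refine ⟨fun i => X.halfNorm n i * x i ^ 2, fun i =>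
    mul_ne_zero (halfNorm_cast_ne_zero n (Or.inr two_ne_zero) i) (pow_ne_zero 2 (hx i)),
    fun i j => ?_⟩
  have hsymm : (X.cartan n i j * X.halfNorm n j : ℝ) = X.cartan n j i * X.halfNorm n i :=
    mod_cast X.cartan_mul_halfNorm n i j
  linear_combination (X.halfNorm n j * x j) * h i j - (X.halfNorm n i * x i) * h j i +
    (x i * x j) * hsymm

end Field

end ClassicalType

theorem isCoxeterElement_wordProd {B W : Type*} [Group W] {M : CoxeterMatrix B}
    (cs : CoxeterSystem M W) {l : List B} (hnodup : l.Nodup) (hl : ∀ i, i ∈ l) :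
    IsCoxeterElement cs (cs.wordProd l) :=
  ⟨l, hnodup, hl, 1, by simp⟩

namespace ClassicalType

theorem two_ne_zero_zmod {X : ClassicalType} {p : ℕ} [Fact p.Prime] (h : X = A ∨ p ≠ 2) :
    X = A ∨ (2 : ZMod p) ≠ 0 := by
  refine h.imp_right fun hp h2 => hp ?_
  rw [← Nat.cast_ofNat, ZMod.natCast_eq_zero_iff] at h2
  exact (Nat.prime_dvd_prime_iff_eq Fact.out Nat.prime_two).1 h2

section Dihedral

variable {X : ClassicalType} {n : ℕ} (hn : X.minRank ≤ n) {W : Type*} [Group W]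
  {cs : CoxeterSystem (X.coxeterMatrix n) W} {c l r : W} (hc : IsCoxeterElement cs c)
  (hb : IsBipartition c l r) {g : Equiv.Perm (NC cs c)} (hg : g ∈ dihedral cs hb)
include hn hc hg

theorem skewExtends_mov {A : Matrix (Fin n) (Fin n) ℝ} (hA : IsCartan (X.coxeterMatrix n) A) :
    SkewExtends (fun w : NC cs c => mov cs hA w.1) g := by
  obtain ⟨d, hd0, hd⟩ := X.exists_symmetrizer hA
  exact skewExtends_mov_of_mem_dihedral hb hA (X.det_ne_zero hA hn) hd hd0 hc hg

theorem skewExtends_movP (p : ℕ) [Fact p.Prime] (hp : X = A ∨ p ≠ 2) :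
    SkewExtends (fun w : NC cs c => movP cs (X.isCartan n) p w.1) g :=
  skewExtends_movP_of_mem_dihedral hb (X.isCartan n) (X.det_cartan_ne_zero hn)
    (X.cartan_mul_halfNorm n) p (halfNorm_cast_ne_zero n (two_ne_zero_zmod hp)) hc hg

end Dihedral

section Form

variable {X : ClassicalType} {n : ℕ} (hn : X.minRank ≤ n) {W : Type*} [Group W]
  (cs : CoxeterSystem (X.coxeterMatrix n) W)

include hn in
theorem mov_wordProd_finRange :
    mov cs (X.isCartan n) (cs.wordProd (List.finRange n)) = ⊤ :=
  mov_coxeterElement cs _ (X.det_cartan_ne_zero hn)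
    (isCoxeterElement_wordProd cs (List.nodup_finRange n) List.mem_finRange)

include hn in
theorem absLength_wordProd_finRange :
    absLength cs (cs.wordProd (List.finRange n)) = Fintype.card (Fin n) :=
  absLength_coxeterElement cs (X.isCartan n) (X.det_cartan_ne_zero hn)
    (isCoxeterElement_wordProd cs (List.nodup_finRange n) List.mem_finRange)

variable {cs} in
include hn in
theorem form_root_eq_zero {s t : W} (hst : Subordinates cs (cs.wordProd (List.finRange n)) s t)
    {u v : Fin n → ℝ} (hu : IsRootOf cs (X.isCartan n) s u) (hv : IsRootOf cs (X.isCartan n) t v) :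
    X.form n ℝ u v = 0 := by
  rw [form_eq_toBilin' X hn]
  exact IsEulerForm.root_eq_zero (X.isEulerMatrix n cs)
    (cartanForm_geomRep cs _ (intCast_mul_comm (X.cartan_mul_halfNorm n)))
    (mov_wordProd_finRange hn cs) (absLength_wordProd_finRange hn cs) hst hu hv

variable {cs} in
include hn in
theorem form_intRoot_eq_zero (K : Type*) [Field K] {s t : W}
    (hst : Subordinates cs (cs.wordProd (List.finRange n)) s t) {u v : Fin n → ℤ}
    (hu : IsIntRootOf cs (X.isCartan n) s u) (hv : IsIntRootOf cs (X.isCartan n) t v) :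
    X.form n K (fun i => (u i : K)) (fun i => (v i : K)) = 0 := by
  rw [form_eq_toBilin' X hn]
  exact (X.isEulerMatrix n cs).root_eq_zero (X.cartan_mul_halfNorm n) (mov_wordProd_finRange hn cs)
    (absLength_wordProd_finRange hn cs) K hst hu hv

include hn in
theorem complementExtends_mov_form :
    ComplementExtends
      (fun w : NC cs (cs.wordProd (List.finRange n)) => mov cs (X.isCartan n) w.1)
      (kreweras cs (cs.wordProd (List.finRange n))) (X.form n ℝ) :=
  complementExtends_mov (mov_wordProd_finRange hn cs)
    (form_nondegenerate hn (Or.inr two_ne_zero))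
    fun _ _ hst _ _ hu hv => form_root_eq_zero hn hst hu hv

include hn in
theorem complementExtends_movP_form (p : ℕ) [Fact p.Prime] (hp : X = A ∨ p ≠ 2) :
    ComplementExtends
      (fun w : NC cs (cs.wordProd (List.finRange n)) => movP cs (X.isCartan n) p w.1)
      (kreweras cs (cs.wordProd (List.finRange n))) (X.form n (ZMod p)) := by
  rw [form_eq_toBilin' X hn]
  exact (X.isEulerMatrix n cs).complementExtends (X.cartan_mul_halfNorm n)
    (mov_wordProd_finRange hn cs) (absLength_wordProd_finRange hn cs) p
    (halfNorm_cast_ne_zero n (two_ne_zero_zmod hp))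

end Form

end ClassicalType

end NonCrossing

open NonCrossing in
theorem mainTheorem5_general :
    (∀ {B W : Type*} [Fintype B] [DecidableEq B] [Group W] {M : CoxeterMatrix B}
      (cs : CoxeterSystem M W) (c : W), IsCoxeterElement cs c →
      ∀ {A : Matrix B B ℝ} (hA : IsCartan M A), A.det ≠ 0 →
      ∀ b : LinearMap.BilinForm ℝ (B → ℝ), b.Nondegenerate →
        (∀ s t, Subordinates cs c s t → ∀ u v,
          IsRootOf cs hA s u → IsRootOf cs hA t v → b u v = 0) →
        ComplementExtends (fun w : NC cs c => mov cs hA w.1) (kreweras cs c) b) ∧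
    (∀ {B W : Type*} [Fintype B] [DecidableEq B] [Group W] {M : CoxeterMatrix B}
      (cs : CoxeterSystem M W) (c : W), IsCoxeterElement cs c →
      ∀ {A : Matrix B B ℤ} (hA : IsCartan M (A.map (Int.cast : ℤ → ℝ))),
        (A.map (Int.cast : ℤ → ℝ)).det ≠ 0 →
      ∀ (p : ℕ) [Fact p.Prime], Compatible cs hA p →
      ∀ b : LinearMap.BilinForm (ZMod p) (B → ZMod p), b.Nondegenerate →
        (∀ s t, Subordinates cs c s t → ∀ u v : B → ℤ,
          IsIntRootOf cs hA s u → IsIntRootOf cs hA t v →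
          b (fun i => (u i : ZMod p)) (fun i => (v i : ZMod p)) = 0) →
        ComplementExtends (fun w : NC cs c => movP cs hA p w.1) (kreweras cs c) b) ∧
    (∀ (X : ClassicalType) (n : ℕ), X.minRank ≤ n →
      ∀ {W : Type*} [Group W] (cs : CoxeterSystem (X.coxeterMatrix n) W) (c l r : W),
      IsCoxeterElement cs c → ∀ hb : IsBipartition c l r, ∀ g ∈ dihedral cs hb,
        (∀ {A : Matrix (Fin n) (Fin n) ℝ} (hA : IsCartan (X.coxeterMatrix n) A),
          SkewExtends (fun w : NC cs c => mov cs hA w.1) g) ∧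
        (∀ (p : ℕ) [Fact p.Prime], (X = ClassicalType.A ∨ p ≠ 2) →
          SkewExtends (fun w : NC cs c => movP cs (X.isCartan n) p w.1) g)) ∧
    (∀ (X : ClassicalType) (n : ℕ), X.minRank ≤ n →
      ∀ {W : Type*} [Group W] (cs : CoxeterSystem (X.coxeterMatrix n) W) (c : W),
      c = cs.wordProd (List.finRange n) →
        ((X.form n ℝ).Nondegenerate ∧
          (∀ s t, Subordinates cs c s t → ∀ u v,
            IsRootOf cs (X.isCartan n) s u → IsRootOf cs (X.isCartan n) t v →
            X.form n ℝ u v = 0) ∧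
          ComplementExtends (fun w : NC cs c => mov cs (X.isCartan n) w.1)
            (kreweras cs c) (X.form n ℝ)) ∧
        (∀ (p : ℕ) [Fact p.Prime], (X = ClassicalType.A ∨ p ≠ 2) →
          (X.form n (ZMod p)).Nondegenerate ∧
          (∀ s t, Subordinates cs c s t → ∀ u v : Fin n → ℤ,
            IsIntRootOf cs (X.isCartan n) s u → IsIntRootOf cs (X.isCartan n) t v →
            X.form n (ZMod p) (fun i => (u i : ZMod p)) (fun i => (v i : ZMod p)) = 0) ∧
          ComplementExtends (fun w : NC cs c => movP cs (X.isCartan n) p w.1)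
            (kreweras cs c) (X.form n (ZMod p)))) := by
  refine ⟨fun cs c hc A hA hdet b hnd hroot => ?_, fun cs c hc A hA hdet p _ hp b hnd hroot => ?_,
    fun X n hn W _ cs c l r hc hb g hg => ⟨fun hA => ?_, fun p _ hp => ?_⟩,
    fun X n hn W _ cs c hc => ?_⟩
  · exact complementExtends_mov (mov_coxeterElement cs hA hdet hc) hnd hroot
  · have hm := mov_coxeterElement cs hA hdet hc
    have hlen := absLength_coxeterElement cs hA hdet hc
    exact complementExtends_movP (.of_compatible hp hm hlen) hm hlen hnd hroot
  · exact ClassicalType.skewExtends_mov hn hc hb hg hA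
  · exact ClassicalType.skewExtends_movP hn hc hb hg p hp
  · subst hc
    refine ⟨⟨?_, fun _ _ hst _ _ hu hv => ?_, ?_⟩,
      fun p _ hp => ⟨?_, fun _ _ hst _ _ hu hv => ?_, ?_⟩⟩
    · exact ClassicalType.form_nondegenerate hn (Or.inr two_ne_zero)
    · exact ClassicalType.form_root_eq_zero hn hst hu hv
    · exact ClassicalType.complementExtends_mov_form hn cs
    · exact ClassicalType.form_nondegenerate hn (ClassicalType.two_ne_zero_zmod hp)
    · exact ClassicalType.form_intRoot_eq_zero hn (ZMod p) hst hu hv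
    · exact ClassicalType.complementExtends_movP_form hn cs p hp

theorem mainTheorem5 :
    -- the criterion for an arbitrary finite Coxeter group and the real geometric representation
    (∀ {B W : Type*} [Fintype B] [DecidableEq B] [Group W] [Finite W] {M : CoxeterMatrix B}
      (cs : CoxeterSystem M W) (c : W), NonCrossing.IsCoxeterElement cs c →
      ∀ {A : Matrix B B ℝ} (hA : NonCrossing.IsCartan M A) (b : LinearMap.BilinForm ℝ (B → ℝ)),
        b.Nondegenerate →
        (∀ s t, NonCrossing.Subordinates cs c s t → ∀ u v,
          NonCrossing.IsRootOf cs hA s u → NonCrossing.IsRootOf cs hA t v → b u v = 0) →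
        NonCrossing.ComplementExtends (fun w : NonCrossing.NC cs c => NonCrossing.mov cs hA w.1)
          (NonCrossing.kreweras cs c) b) ∧
    -- the criterion for a crystallographic root system and a compatible prime
    (∀ {B W : Type*} [Fintype B] [DecidableEq B] [Group W] [Finite W] {M : CoxeterMatrix B}
      (cs : CoxeterSystem M W) (c : W), NonCrossing.IsCoxeterElement cs c →
      ∀ {A : Matrix B B ℤ} (hA : NonCrossing.IsCartan M (A.map (Int.cast : ℤ → ℝ)))
        (p : ℕ) [Fact p.Prime], NonCrossing.Compatible cs hA p →
      ∀ b : LinearMap.BilinForm (ZMod p) (B → ZMod p), b.Nondegenerate →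
        (∀ s t, NonCrossing.Subordinates cs c s t → ∀ u v : B → ℤ,
          NonCrossing.IsIntRootOf cs hA s u → NonCrossing.IsIntRootOf cs hA t v →
          b (fun i => (u i : ZMod p)) (fun i => (v i : ZMod p)) = 0) →
        NonCrossing.ComplementExtends
          (fun w : NonCrossing.NC cs c => NonCrossing.movP cs hA p w.1)
          (NonCrossing.kreweras cs c) b) ∧
    -- in the classical types, all elements of the dihedral group extend
    (∀ (X : NonCrossing.ClassicalType) (n : ℕ), X.minRank ≤ n →
      ∀ {W : Type*} [Group W] (cs : CoxeterSystem (X.coxeterMatrix n) W) (c l r : W),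
      NonCrossing.IsCoxeterElement cs c → ∀ hb : NonCrossing.IsBipartition c l r,
      ∀ g ∈ NonCrossing.dihedral cs hb,
        (∀ {A : Matrix (Fin n) (Fin n) ℝ} (hA : NonCrossing.IsCartan (X.coxeterMatrix n) A),
          NonCrossing.SkewExtends
            (fun w : NonCrossing.NC cs c => NonCrossing.mov cs hA w.1) g) ∧
        (∀ (p : ℕ) [Fact p.Prime], (X = NonCrossing.ClassicalType.A ∨ p ≠ 2) →
          NonCrossing.SkewExtends
            (fun w : NonCrossing.NC cs c => NonCrossing.movP cs (X.isCartan n) p w.1) g)) ∧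
    -- the explicit forms, for the Coxeter element `s_1 ⋯ s_n`
    (∀ (X : NonCrossing.ClassicalType) (n : ℕ), X.minRank ≤ n →
      ∀ {W : Type*} [Group W] (cs : CoxeterSystem (X.coxeterMatrix n) W) (c : W),
      c = cs.wordProd (List.finRange n) →
        ((X.form n ℝ).Nondegenerate ∧
          (∀ s t, NonCrossing.Subordinates cs c s t → ∀ u v,
            NonCrossing.IsRootOf cs (X.isCartan n) s u →
            NonCrossing.IsRootOf cs (X.isCartan n) t v → X.form n ℝ u v = 0) ∧
          NonCrossing.ComplementExtends
            (fun w : NonCrossing.NC cs c => NonCrossing.mov cs (X.isCartan n) w.1)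
            (NonCrossing.kreweras cs c) (X.form n ℝ)) ∧
        (∀ (p : ℕ) [Fact p.Prime], (X = NonCrossing.ClassicalType.A ∨ p ≠ 2) →
          (X.form n (ZMod p)).Nondegenerate ∧
          (∀ s t, NonCrossing.Subordinates cs c s t → ∀ u v : Fin n → ℤ,
            NonCrossing.IsIntRootOf cs (X.isCartan n) s u →
            NonCrossing.IsIntRootOf cs (X.isCartan n) t v →
            X.form n (ZMod p) (fun i => (u i : ZMod p)) (fun i => (v i : ZMod p)) = 0) ∧
          NonCrossing.ComplementExtends
            (fun w : NonCrossing.NC cs c => NonCrossing.movP cs (X.isCartan n) p w.1)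
            (NonCrossing.kreweras cs c) (X.form n (ZMod p)))) := by
  obtain ⟨hreal, hmodular, hclassical⟩ := mainTheorem5_general
  exact ⟨fun cs c hc _ hA => hreal cs c hc hA (NonCrossing.det_ne_zero_of_finite cs hA),
    fun cs c hc _ hA => hmodular cs c hc hA (NonCrossing.det_ne_zero_of_finite cs hA), hclassical⟩
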